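/- For a sequence $(w_0,w_1,\dots)$ of positive integers write $[w_0,w_1,\dots]=\cfrac{1}{w_0+\cfrac{1}{w_1+\cdots}}\in[0,1]$, and similarly $[w_0,\dots,w_k]$ for finite sequences (the empty one has value $0$). Let $\mathbb N=\{1,2,\dots\}$, let $\sigma$ be the shift on $\mathbb N^{\{0,1,2,\dots\}}$ or on $\mathbb N^{\mathbb Z}$, and put $g_n(y)=1/(n+y)$. A Gibbs state of a real function $\psi$ on one of these two sequence spaces is a $\sigma$-invariant Borel probability measure $\nu$ for which there are $C\ge 1$ and $P\in\mathbb R$ with $$C^{-1}\le\frac{\nu(\{\omega:\ \omega_i=\tau_i\text{ for }0\le i<n\})}{\exp\big(\sum_{j=0}^{n-1}\psi(\sigma^j\tau)-Pn\big)}\le C$$ for all $n\ge1$ and all sequences $\tau$. For $s>1/2$ let $$\zeta_s(\omega)=s\log\big|g_{\omega_0}'([\omega_1,\omega_2,\dots])\big|=-2s\log\big(\omega_0+[\omega_1,\omega_2,\dots]\big),\qquad \omega\in\mathbb N^{\{0,1,\dots\}},$$ that is, $\zeta_s(\omega)=-s\log|G'(x)|$ at $x=[\omega_0,\omega_1,\dots]$,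 where $G(x)=\frac1x-\lfloor\frac1x\rfloor$ is the Gauss map. Theorem. Let $s>1/2$. Then $\zeta_s$ has exactly one Gibbs state $\nu_s$ on $\mathbb N^{\{0,1,\dots\}}$, and the function $\tau\mapsto\zeta_s(\tau_0,\tau_1,\dots)$ has exactly one Gibbs state $\hat\nu_s$ on $\mathbb N^{\mathbb Z}$. Let $\mu_s$ be the image of $\nu_s$ under $\omega\mapsto[\omega_0,\omega_1,\dots]$, and let $\hat\mu_s$, the lift of $\mu_s$ to the natural extension $(x,y)\mapsto\big(G(x),\,1/(\lfloor 1/x\rfloor+y)\big)$ of $G$, be the image of $\hat\nu_s$ under $\tau\mapsto([\tau_0,\tau_1,\dots],[\tau_{-1},\tau_{-2},\dots])$. For irrational $x=[a_1,a_2,\dots]\in[0,1]$ and $k\ge0$ put $T_k(x)=[a_{k+1},a_{k+2},\dots]$ and $V_k(x)=[a_k,\dots,a_1]$ (so $T_0(x)=x$ and $V_0(x)=0$). Then for $\mu_s$-a.e. $x\in[0,1]$ and for all real numbers $a<b$ and $c<d$, $$\lim_{n\to\infty}\frac{\#\{k\in\{0,\dots,n-1\}:\ (T_k(x),V_k(x))\in(a,b)\times(c,d)\}}{n}=\hat\mu_s\big((a,b)\times(c,d)\big).$$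 -/

import Mathlib

open MeasureTheory Filter Topology Set

namespace GaussCF

noncomputable section

/-- The alphabet `ℕ+ = {1, 2, …}` carries the discrete σ-algebra, so that the sequence spaces
`ℕ → ℕ+` and `ℤ → ℕ+` carry the Borel σ-algebra of the product topology. -/
instance : MeasurableSpace ℕ+ := ⊤

/-! ### Gibbs states on the full one-sided and two-sided shifts over `ℕ+` -/

/-- The one-sided shift `(ω₀, ω₁, …) ↦ (ω₁, ω₂, …)`. -/
def shift (ω : ℕ → ℕ+) : ℕ → ℕ+ := fun n => ω (n + 1)

/-- The two-sided shift. -/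
def shiftZ (τ : ℤ → ℕ+) : ℤ → ℕ+ := fun n => τ (n + 1)

/-- `[τ|₀ⁿ⁻¹]`: the one-sided sequences which agree with `τ` at the indices `0, …, n - 1`. -/
def cylinder (τ : ℕ → ℕ+) (n : ℕ) : Set (ℕ → ℕ+) := {ω | ∀ i, i < n → ω i = τ i}

/-- `[τ|₀ⁿ⁻¹]`: the two-sided sequences which agree with `τ` at the indices `0, …, n - 1`. -/
def cylinderZ (τ : ℤ → ℕ+) (n : ℕ) : Set (ℤ → ℕ+) :=
  {ω | ∀ i : ℕ, i < n → ω (i : ℤ) = τ (i : ℤ)}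

/-- A Gibbs state of the potential `ψ` on the one-sided shift: a shift-invariant Borel probability
measure `μ` for which `μ [τ|₀ⁿ⁻¹] / exp (S_n ψ (τ) - P n)` lies between two positive constants. -/
def IsGibbsState (ψ : (ℕ → ℕ+) → ℝ) (μ : Measure (ℕ → ℕ+)) : Prop :=
  IsProbabilityMeasure μ ∧ MeasurePreserving shift μ μ ∧
    ∃ C : ℝ, 1 ≤ C ∧ ∃ P : ℝ, ∀ n : ℕ, 1 ≤ n → ∀ τ : ℕ → ℕ+,
      C⁻¹ ≤ μ.real (cylinder τ n) / Real.exp (birkhoffSum shift ψ n τ - P * n) ∧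
      μ.real (cylinder τ n) / Real.exp (birkhoffSum shift ψ n τ - P * n) ≤ C

/-- A Gibbs state of the potential `ψ` on the two-sided shift. -/
def IsGibbsStateZ (ψ : (ℤ → ℕ+) → ℝ) (μ : Measure (ℤ → ℕ+)) : Prop :=
  IsProbabilityMeasure μ ∧ MeasurePreserving shiftZ μ μ ∧
    ∃ C : ℝ, 1 ≤ C ∧ ∃ P : ℝ, ∀ n : ℕ, 1 ≤ n → ∀ τ : ℤ → ℕ+,
      C⁻¹ ≤ μ.real (cylinderZ τ n) / Real.exp (birkhoffSum shiftZ ψ n τ - P * n) ∧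
      μ.real (cylinderZ τ n) / Real.exp (birkhoffSum shiftZ ψ n τ - P * n) ≤ C

open Classical in
/-- The Gibbs state of `ψ` on the one-sided shift (`0` if there is none). -/
def gibbsState (ψ : (ℕ → ℕ+) → ℝ) : Measure (ℕ → ℕ+) :=
  if h : ∃ μ, IsGibbsState ψ μ then h.choose else 0

open Classical in
/-- The Gibbs state of `ψ` on the two-sided shift (`0` if there is none). -/
def gibbsStateZ (ψ : (ℤ → ℕ+) → ℝ) : Measure (ℤ → ℕ+) :=
  if h : ∃ μ, IsGibbsStateZ ψ μ then h.choose else 0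

/-! ### Continued fractions -/

/-- The inverse branch `g_n(y) = 1 / (n + y)` of the Gauss map. -/
def branch (n : ℕ) (y : ℝ) : ℝ := 1 / ((n : ℝ) + y)

/-- The finite continued fraction `[a₁, …, a_k] = 1 / (a₁ + 1 / (a₂ + … + 1 / a_k))`;
the empty one is `0`. -/
def cfFin (l : List ℕ) : ℝ := l.foldr branch 0

/-- The infinite continued fraction `[w₀, w₁, w₂, …]`, the limit of `[w₀, …, w_{n-1}]`. -/
def cf (w : ℕ → ℕ) : ℝ := limUnder atTop fun n => cfFin ((List.range n).map w)

/-- The coding map `ω ↦ [ω₀, ω₁, …]` from sequences of positive integers to `[0, 1]`. -/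
def coding (ω : ℕ → ℕ+) : ℝ := cf fun i => (ω i : ℕ)

/-- The Gauss map `x ↦ 1 / x - ⌊1 / x⌋` (with value `0` at `0`). -/
def gaussMap (x : ℝ) : ℝ := Int.fract (1 / x)

/-- The continued fraction digits of `x ∈ [0, 1]`, indexed from `0`:
`x = [digit x 0, digit x 1, …]` if `x` is irrational. -/
def digit (x : ℝ) (k : ℕ) : ℕ := ⌊1 / gaussMap^[k] x⌋₊

/-- The future `T_k(x) = [a_{k+1}, a_{k+2}, …]` of `x = [a₁, a₂, …]`, where
`a_{i+1} = digit x i`. -/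
def T (k : ℕ) (x : ℝ) : ℝ := cf fun i => digit x (k + i)

/-- The reversed past `V_k(x) = [a_k, …, a₁]` of `x = [a₁, a₂, …]`; `V_0(x) = 0`. -/
def V (k : ℕ) (x : ℝ) : ℝ := cfFin ((List.range k).map (digit x)).reverse

/-! ### The measures `μ_s` and `μ̂_s` -/

/-- The geometric potential on the one-sided shift,
`ζ_s(ω) = s log |g'_{ω₀}([ω₁, ω₂, …])| = -s log |G'([ω₀, ω₁, …])|`, where `G` is the Gauss map. -/
def zeta (s : ℝ) (ω : ℕ → ℕ+) : ℝ :=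
  s * Real.log |deriv (branch (ω 0)) (coding (shift ω))|

/-- The nonnegative part `τ₀ τ₁ τ₂ …` of a two-sided sequence. -/
def future (τ : ℤ → ℕ+) : ℕ → ℕ+ := fun n => τ n

/-- The negative part of a two-sided sequence, read backwards: `τ₋₁ τ₋₂ τ₋₃ …`. -/
def past (τ : ℤ → ℕ+) : ℕ → ℕ+ := fun n => τ (-((n : ℤ) + 1))

/-- `μ_s`: the Gibbs (equilibrium) state of `ζ_s`, transported to the real line by the coding
map. -/
def mu (s : ℝ) : Measure ℝ := (gibbsState (zeta s)).map coding

/-- The projection of the two-sided shift onto the natural extension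
`(x, y) ↦ (G x, 1 / (a₁(x) + y))` of the Gauss map:
`τ ↦ ([τ₀, τ₁, …], [τ₋₁, τ₋₂, …])`. The second coordinate is the only common point of the sets
`g_{τ₋₁} ∘ … ∘ g_{τ₋ₙ} ([0, 1])`. -/
def codingZ (τ : ℤ → ℕ+) : ℝ × ℝ := (coding (future τ), coding (past τ))

/-- `μ̂_s`: the Gibbs (equilibrium) state on the two-sided shift of the lifted potential
`τ ↦ ζ_s(τ₀ τ₁ …)`, transported to the natural extension of the Gauss map. -/
def muHat (s : ℝ) : Measure (ℝ × ℝ) := (gibbsStateZ fun τ => zeta s (future τ)).map codingZ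

/-! ### The limits in `cf` exist, and the coding maps are measurable -/

lemma branch_mem {n : ℕ} (hn : 1 ≤ n) {y : ℝ} (hy : y ∈ Icc (0 : ℝ) 1) :
    branch n y ∈ Icc (0 : ℝ) 1 := by
  have h1 : (1 : ℝ) ≤ n := by exact_mod_cast hn
  have h2 : (0 : ℝ) < n + y := by linarith [hy.1]
  refine ⟨by unfold branch; positivity, ?_⟩
  unfold branch
  rw [div_le_one h2]
  linarith [hy.1]

lemma foldr_branch_mem (l : List ℕ) (hl : ∀ a ∈ l, 1 ≤ a) {y : ℝ} (hy : y ∈ Icc (0 : ℝ) 1) :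
    l.foldr branch y ∈ Icc (0 : ℝ) 1 := by
  induction l with
  | nil => simpa using hy
  | cons a l ih =>
    simp only [List.foldr_cons]
    exact branch_mem (hl a (by simp)) (ih fun b hb => hl b (by simp [hb]))

lemma branch_sub {n : ℕ} (hn : 1 ≤ n) {x y : ℝ} (hx : x ∈ Icc (0 : ℝ) 1)
    (hy : y ∈ Icc (0 : ℝ) 1) : |branch n x - branch n y| = |x - y| / ((n + x) * (n + y)) := by
  have h1 : (1 : ℝ) ≤ n := by exact_mod_cast hn
  have hx2 : (0 : ℝ) < n + x := by linarith [hx.1]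
  have hy2 : (0 : ℝ) < n + y := by linarith [hy.1]
  have : branch n x - branch n y = (y - x) / ((n + x) * (n + y)) := by
    unfold branch; field_simp; ring
  rw [this, abs_div, abs_of_pos (mul_pos hx2 hy2), abs_sub_comm]

lemma branch_branch {a b : ℕ} (ha : 1 ≤ a) (hb : 1 ≤ b) {x y : ℝ} (hx : x ∈ Icc (0 : ℝ) 1)
    (hy : y ∈ Icc (0 : ℝ) 1) :
    |branch a (branch b x) - branch a (branch b y)| ≤ |x - y| / 4 := by
  have ha1 : (1 : ℝ) ≤ a := by exact_mod_cast ha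
  have hb1 : (1 : ℝ) ≤ b := by exact_mod_cast hb
  have key : ∀ z ∈ Icc (0 : ℝ) 1, 2 ≤ (a + branch b z) * (b + z) := by
    intro z hz
    have h2 : (0 : ℝ) < b + z := by linarith [hz.1]
    have : branch b z * (b + z) = 1 := by unfold branch; field_simp
    nlinarith [hz.1]
  rw [branch_sub ha (branch_mem hb hx) (branch_mem hb hy), branch_sub hb hx hy, div_div]
  refine div_le_div_of_nonneg_left (abs_nonneg _) (by norm_num) ?_
  nlinarith [key x hx, key y hy]

lemma foldr_branch_sub : ∀ (l : List ℕ), (∀ a ∈ l, 1 ≤ a) → ∀ {x y : ℝ}, x ∈ Icc (0 : ℝ) 1 →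
    y ∈ Icc (0 : ℝ) 1 →
    |l.foldr branch x - l.foldr branch y| ≤ 2 * (1 / 2) ^ l.length * |x - y|
  | [], _, x, y, _, _ => by simp; linarith [abs_nonneg (x - y)]
  | [a], h, x, y, hx, hy => by
    have ha : (1 : ℝ) ≤ a := by exact_mod_cast h a (by simp)
    simp only [List.foldr_cons, List.foldr_nil, List.length_cons, List.length_nil]
    rw [branch_sub (h a (by simp)) hx hy]
    norm_num
    exact div_le_self (abs_nonneg _) (by nlinarith [hx.1, hy.1])
  | a :: b :: l, h, x, y, hx, hy => by
    have hl : ∀ c ∈ l, 1 ≤ c := fun c hc => h c (by simp [hc])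
    have ih := foldr_branch_sub l hl hx hy
    have h2 := branch_branch (h a (by simp)) (h b (by simp)) (foldr_branch_mem l hl hx)
      (foldr_branch_mem l hl hy)
    simp only [List.foldr_cons, List.length_cons, pow_succ] at *
    linarith

lemma tendsto_cf {w : ℕ → ℕ} (hw : ∀ i, 1 ≤ w i) :
    Tendsto (fun n => cfFin ((List.range n).map w)) atTop (𝓝 (cf w)) := by
  refine CauchySeq.tendsto_limUnder (cauchySeq_of_le_geometric (1 / 2) 2 (by norm_num) ?_)
  intro n
  have hl : ∀ a ∈ (List.range n).map w, 1 ≤ a := by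
    intro a ha
    obtain ⟨i, -, rfl⟩ := List.mem_map.1 ha
    exact hw i
  have h0 : (0 : ℝ) ∈ Icc (0 : ℝ) 1 := by simp
  have h1 := branch_mem (hw n) h0
  have h2 := foldr_branch_sub _ hl h0 h1
  rw [List.length_map, List.length_range] at h2
  simp only [cfFin, List.range_succ, List.map_append, List.map_cons, List.map_nil,
    List.foldr_append, List.foldr_cons, List.foldr_nil]
  rw [Real.dist_eq]
  refine h2.trans ?_
  have h3 : |0 - branch (w n) 0| ≤ 1 := by
    rw [abs_sub_comm, sub_zero, abs_of_nonneg h1.1]; exact h1.2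
  have h4 : (0 : ℝ) ≤ 2 * (1 / 2) ^ n := by positivity
  nlinarith

lemma measurable_coding : Measurable coding := by
  have hw : ∀ (ω : ℕ → ℕ+) i, 1 ≤ (ω i : ℕ) := fun ω i => (ω i).pos
  refine measurable_of_tendsto_metrizable
    (f := fun n (ω : ℕ → ℕ+) => cfFin ((List.range n).map fun i => (ω i : ℕ))) (fun n => ?_)
    (tendsto_pi_nhds.2 fun ω => tendsto_cf (hw ω))
  have hm : ∀ l : List ℕ, Measurable fun ω : ℕ → ℕ+ => cfFin (l.map fun i => (ω i : ℕ)) := by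
    intro l
    induction l with
    | nil => simp [cfFin]
    | cons a l ih =>
      simp only [cfFin, List.map_cons, List.foldr_cons, branch] at ih ⊢
      have hc : Measurable fun ω : ℕ → ℕ+ => ((ω a : ℕ) : ℝ) :=
        (measurable_from_top (f := fun m : ℕ+ => ((m : ℕ) : ℝ))).comp (measurable_pi_apply a)
      exact (hc.add ih).const_div 1
  exact hm _

lemma measurable_codingZ : Measurable codingZ := by
  have h1 : Measurable future := measurable_pi_lambda _ fun n => measurable_pi_apply _
  have h2 : Measurable past := measurable_pi_lambda _ fun n => measurable_pi_apply _
  exact (measurable_coding.comp h1).prodMk (measurable_coding.comp h2)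

end

end GaussCF

/-! Uniqueness and ergodicity follow from the Gibbs bounds alone. On the full shift they make the
measure quasi-multiplicative: $\mu([u])\,\mu(B)\le C^3\mu([u]\cap\sigma^{-n}B)$ for a word $u$ of
length $n$. For invariant $B$ this extends from cylinders to all sets and gives $\mu(B)\mu(B^c)=0$
(`IsGibbsState.ergodic`). Two Gibbs states of one potential have the same pressure, hence are
comparable on cylinders, hence one is absolutely continuous with respect to the other, and
ergodicity makes them equal (`IsGibbsState.eq`). A two-sided invariant measure is determined by its
future marginal, so two-sided uniqueness reduces to this.

Existence comes from periodic orbits. The denominators behind $S_n\zeta_s$ are, up to bounded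
factors, traces of products of the matrices $\begin{pmatrix}k&1\\1&0\end{pmatrix}$. Traces are
almost multiplicative on these products and invariant under cyclic rotation. Dirac masses at
periodic sequences, weighted by $(\operatorname{tr})^{-2s}$ and normalized, are therefore
shift-invariant and satisfy Gibbs bounds uniform in the period. Convergence of $\sum k^{-2s}$ makes
them tight, and a limit point is a two-sided Gibbs state (`exists_isGibbsStateZ`); its future
marginal is the one-sided state.

For equidistribution, $V_{k+m}(x)$ is within $2\cdot2^{-m}$ of a function of the $m$ letters
following position $k$. Up to that error and an index shift by $m$, visits of $(T_k,V_k)$ to a box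
are visits of the one-sided orbit to a fixed set `approxBox`, to which Birkhoff's theorem applies.
Letting $m\to\infty$ costs nothing, because Gibbs states give no mass to single futures or pasts, so
the sides of boxes are null (`ae_tendsto_frequency`). -/

namespace GaussCF

/-! ### The pointwise ergodic theorem for bounded functions -/

section Birkhoff

variable {X : Type*} {f : X → X} {g : X → ℝ}

/-- The maximum of the Birkhoff sums `S₀ g, …, Sₙ g`. -/
noncomputable def maxSum (f : X → X) (g : X → ℝ) : ℕ → X → ℝ
  | 0, _ => 0
  | n + 1, x => max 0 (g x + maxSum f g n (f x))

lemma maxSum_nonneg (n : ℕ) (x : X) : 0 ≤ maxSum f g n x := by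
  cases n <;> simp [maxSum]

lemma maxSum_le_succ (n : ℕ) (x : X) : maxSum f g n x ≤ maxSum f g (n + 1) x := by
  induction n generalizing x with
  | zero => simp [maxSum]
  | succ n ih =>
    rw [maxSum, maxSum]
    gcongr
    exact ih (f x)

lemma monotone_maxSum (x : X) : Monotone fun n => maxSum f g n x :=
  monotone_nat_of_le_succ fun n => maxSum_le_succ n x

lemma birkhoffSum_le_maxSum (n : ℕ) (x : X) : birkhoffSum f g n x ≤ maxSum f g n x := by
  induction n generalizing x with
  | zero => simp [maxSum]
  | succ n ih =>
    rw [birkhoffSum_succ', maxSum]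
    exact le_max_of_le_right (by linarith [ih (f x)])

lemma maxSum_le {B : ℝ} (hB : ∀ x, |g x| ≤ B) (n : ℕ) (x : X) : maxSum f g n x ≤ n * B := by
  induction n generalizing x with
  | zero => simp [maxSum]
  | succ n ih =>
    have h0 : 0 ≤ B := (abs_nonneg _).trans (hB x)
    rw [maxSum]
    push_cast
    refine max_le (by positivity) ?_
    linarith [ih (f x), (abs_le.1 (hB x)).2]

lemma birkhoffSum_sub_const (f : X → X) (g : X → ℝ) (c : ℝ) (n : ℕ) (x : X) :
    birkhoffSum f (fun x => g x - c) n x = birkhoffSum f g n x - n * c := by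
  simp [birkhoffSum, Finset.sum_sub_distrib]

variable [MeasurableSpace X] {μ : Measure X}

lemma measurable_maxSum (hf : Measurable f) (hg : Measurable g) (n : ℕ) :
    Measurable (maxSum f g n) := by
  induction n with
  | zero => exact measurable_const
  | succ n ih => exact measurable_const.max (hg.add (ih.comp hf))

/-- Maximal ergodic theorem: the Birkhoff sums of a function with negative integral are bounded
above almost everywhere. -/
theorem ae_bddAbove_birkhoffSum [IsProbabilityMeasure μ] (hf : Ergodic f μ) (hg : Measurable g)
    {B : ℝ} (hB : ∀ x, |g x| ≤ B) (hneg : ∫ x, g x ∂μ < 0) :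
    ∀ᵐ x ∂μ, BddAbove (range fun n => birkhoffSum f g n x) := by
  have hfm := hf.measurable
  have hm := fun n => measurable_maxSum hfm hg n
  set A : Set X := ⋂ j : ℕ, ⋃ n, {x | (j : ℝ) < maxSum f g n x} with hA
  have hAm : MeasurableSet A :=
    .iInter fun j => .iUnion fun n => measurableSet_lt measurable_const (hm n)
  have hmem : ∀ x, x ∈ A ↔ ¬ BddAbove (range fun n => maxSum f g n x) := by
    intro x
    simp only [hA, mem_iInter, mem_iUnion, mem_ofPred_eq, not_bddAbove_iff, mem_range,
      exists_exists_eq_and]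
    refine ⟨fun h c => ?_, fun h j => h j⟩
    obtain ⟨j, hj⟩ := exists_nat_gt c
    obtain ⟨n, hn⟩ := h j
    exact ⟨n, hj.trans hn⟩
  have hinv : f ⁻¹' A = A := by
    ext x
    rw [mem_preimage, hmem, hmem, not_iff_not]
    constructor
    · rintro ⟨c, hc⟩
      refine ⟨max 0 (g x + c), ?_⟩
      rintro _ ⟨n, rfl⟩
      refine (maxSum_le_succ n x).trans ?_
      simp only [maxSum]
      gcongr
      exact hc ⟨n, rfl⟩
    · rintro ⟨c, hc⟩
      refine ⟨c - g x, ?_⟩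
      rintro _ ⟨n, rfl⟩
      have h1 : maxSum f g (n + 1) x ≤ c := hc ⟨n + 1, rfl⟩
      have h2 : g x + maxSum f g n (f x) ≤ c := (le_max_right _ _).trans h1
      show maxSum f g n (f x) ≤ _
      linarith
  have hA0 : μ A = 0 := by
    -- If `A` had full measure, `maxSum (n + 1) - maxSum n ∘ f` would have nonnegative integral and
    -- converge boundedly to `g`, contradicting `hneg`.
    rcases hf.toPreErgodic.prob_eq_zero_or_one hAm hinv with h | h
    · exact h
    exfalso
    have hAae : ∀ᵐ x ∂μ, x ∈ A := (prob_compl_eq_zero_iff hAm).2 h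
    have hint : ∀ n, Integrable (maxSum f g n) μ := fun n =>
      Integrable.of_bound (hm n).aestronglyMeasurable (n * B) (ae_of_all _ fun x => by
        rw [Real.norm_eq_abs, abs_of_nonneg (maxSum_nonneg _ _)]
        exact maxSum_le hB n x)
    have hcomp : ∀ n, Integrable (fun x => maxSum f g n (f x)) μ := fun n =>
      hf.toMeasurePreserving.integrable_comp_of_integrable (hint n)
    have hpos : ∀ n, 0 ≤ ∫ x, (maxSum f g (n + 1) x - maxSum f g n (f x)) ∂μ := by
      intro n
      rw [integral_sub (hint _) (hcomp n)]
      have : ∫ x, maxSum f g n (f x) ∂μ = ∫ x, maxSum f g n x ∂μ := by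
        conv_rhs => rw [← hf.toMeasurePreserving.map_eq]
        rw [integral_map hfm.aemeasurable (hm n).aestronglyMeasurable]
      rw [this, sub_nonneg]
      exact integral_mono (hint n) (hint _) (maxSum_le_succ n)
    have hlim : Tendsto (fun n => ∫ x, (maxSum f g (n + 1) x - maxSum f g n (f x)) ∂μ) atTop
        (𝓝 (∫ x, g x ∂μ)) := by
      refine tendsto_integral_of_dominated_convergence (fun _ => B)
        (fun n => ((hm _).sub ((hm n).comp hfm)).aestronglyMeasurable) (integrable_const _)
        (fun n => ae_of_all _ fun x => ?_) ?_
      · rw [Real.norm_eq_abs, maxSum]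
        have h1 := abs_le.1 (hB x)
        have h2 : 0 ≤ maxSum f g n (f x) := maxSum_nonneg _ _
        rcases le_total 0 (g x + maxSum f g n (f x)) with h3 | h3
        · rw [max_eq_right h3, abs_le]
          constructor <;> linarith
        · rw [max_eq_left h3, abs_le]
          constructor <;> linarith
      · filter_upwards [hAae] with x hx
        -- Once `maxSum f g n (f x)` exceeds `-g x`, the maximum with `0` is inactive and the
        -- difference equals `g x` exactly.
        have hx' : f x ∈ A := by rwa [← mem_preimage, hinv]
        rw [hmem, not_bddAbove_iff] at hx'
        obtain ⟨_, ⟨N, rfl⟩, hN⟩ := hx' (-g x)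
        refine tendsto_const_nhds.congr' ?_
        filter_upwards [eventually_ge_atTop N] with n hn
        have h1 : maxSum f g N (f x) ≤ maxSum f g n (f x) := monotone_maxSum (f x) hn
        dsimp only at hN
        rw [maxSum, max_eq_right (by linarith)]
        ring
    exact absurd (ge_of_tendsto' hlim hpos) (not_le.2 hneg)
  filter_upwards [measure_eq_zero_iff_ae_notMem.1 hA0] with x hx
  rw [hmem, not_not] at hx
  obtain ⟨c, hc⟩ := hx
  refine ⟨c, ?_⟩
  rintro _ ⟨n, rfl⟩
  exact (birkhoffSum_le_maxSum n x).trans (hc ⟨n, rfl⟩)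

/-- The maximal theorem for `g - c'`, with `c'` strictly between the integral and `c`, bounds the
average by `M / n + c'`. -/
lemma ae_eventually_birkhoffAverage_lt [IsProbabilityMeasure μ] (hf : Ergodic f μ)
    (hg : Measurable g) {B : ℝ} (hB : ∀ x, |g x| ≤ B) {c : ℝ} (hc : ∫ x, g x ∂μ < c) :
    ∀ᵐ x ∂μ, ∀ᶠ n : ℕ in atTop, birkhoffAverage ℝ f g n x < c := by
  obtain ⟨c', hc1, hc2⟩ := exists_between hc
  have hint : Integrable g μ := Integrable.of_bound hg.aestronglyMeasurable B (ae_of_all _ hB)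
  have h := ae_bddAbove_birkhoffSum (g := fun x => g x - c') hf (hg.sub_const _)
    (B := B + |c'|) (fun x => (abs_sub _ _).trans (by gcongr; exact hB x)) (by
      rw [integral_sub hint (integrable_const _)]
      simpa using hc1)
  filter_upwards [h] with x hx
  obtain ⟨M, hM⟩ := hx
  have hlim : Tendsto (fun n : ℕ => M / (n : ℝ) + c') atTop (𝓝 (0 + c')) :=
    (tendsto_const_div_atTop_nhds_zero_nat M).add_const _
  rw [zero_add] at hlim
  filter_upwards [hlim.eventually_lt_const hc2, eventually_gt_atTop 0] with n hn hn0
  refine lt_of_le_of_lt ?_ hn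
  have hn' : (0 : ℝ) < n := by exact_mod_cast hn0
  have h1 : birkhoffSum f (fun x => g x - c') n x ≤ M := hM ⟨n, rfl⟩
  rw [birkhoffSum_sub_const] at h1
  rw [birkhoffAverage, smul_eq_mul, inv_mul_eq_div, div_add' _ _ _ hn'.ne']
  gcongr
  linarith

/-- **Birkhoff's ergodic theorem** for bounded functions. -/
theorem tendsto_birkhoffAverage_of_ergodic [IsProbabilityMeasure μ] (hf : Ergodic f μ)
    (hg : Measurable g) {B : ℝ} (hB : ∀ x, |g x| ≤ B) :
    ∀ᵐ x ∂μ, Tendsto (fun n => birkhoffAverage ℝ f g n x) atTop (𝓝 (∫ x, g x ∂μ)) := by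
  have h1 : ∀ᵐ x ∂μ, ∀ k : ℕ, ∀ᶠ n : ℕ in atTop,
      birkhoffAverage ℝ f g n x < ∫ x, g x ∂μ + 1 / (k + 1) := ae_all_iff.2 fun k =>
    ae_eventually_birkhoffAverage_lt hf hg hB (lt_add_of_pos_right _ (by positivity))
  have h2 : ∀ᵐ x ∂μ, ∀ k : ℕ, ∀ᶠ n : ℕ in atTop,
      birkhoffAverage ℝ f (-g) n x < -∫ x, g x ∂μ + 1 / (k + 1) := ae_all_iff.2 fun k =>
    ae_eventually_birkhoffAverage_lt hf hg.neg (B := B) (fun x => by simpa using hB x) (by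
      simp only [Pi.neg_apply, integral_neg]
      exact lt_add_of_pos_right _ (by positivity))
  filter_upwards [h1, h2] with x hx1 hx2
  rw [tendsto_order]
  constructor
  · intro a ha
    obtain ⟨k, hk⟩ := exists_nat_one_div_lt (sub_pos.2 ha)
    filter_upwards [hx2 k] with n hn
    rw [birkhoffAverage_neg] at hn
    simp only [Pi.neg_apply] at hn
    linarith
  · intro a ha
    obtain ⟨k, hk⟩ := exists_nat_one_div_lt (sub_pos.2 ha)
    filter_upwards [hx1 k] with n hn
    linarith

end Birkhoff

/-! ### Cylinders of the one-sided shift -/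

/-- The first `n` letters of a sequence. -/
def prefixWord (n : ℕ) (ω : ℕ → ℕ+) : Fin n → ℕ+ := fun i => ω i

lemma measurable_prefixWord (n : ℕ) : Measurable (prefixWord n) :=
  measurable_pi_lambda _ fun i => measurable_pi_apply (i : ℕ)

lemma cylinder_eq_preimage (τ : ℕ → ℕ+) (n : ℕ) :
    cylinder τ n = prefixWord n ⁻¹' {prefixWord n τ} := by
  ext ω
  simp only [cylinder, prefixWord, mem_ofPred_eq, mem_preimage, mem_singleton_iff, funext_iff]
  exact ⟨fun h i => h i i.2, fun h i hi => h ⟨i, hi⟩⟩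

lemma measurableSet_cylinder (τ : ℕ → ℕ+) (n : ℕ) : MeasurableSet (cylinder τ n) := by
  rw [cylinder_eq_preimage]
  exact measurable_prefixWord n (measurableSet_singleton _)

lemma self_mem_cylinder (τ : ℕ → ℕ+) (n : ℕ) : τ ∈ cylinder τ n := fun _ _ => rfl

lemma cylinder_anti (τ : ℕ → ℕ+) {m n : ℕ} (h : m ≤ n) : cylinder τ n ⊆ cylinder τ m :=
  fun _ hω i hi => hω i (hi.trans_le h)

lemma cylinder_congr {τ ρ : ℕ → ℕ+} {n : ℕ} (h : ∀ i, i < n → τ i = ρ i) :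
    cylinder τ n = cylinder ρ n := by
  ext ω
  exact ⟨fun hω i hi => (hω i hi).trans (h i hi), fun hω i hi => (hω i hi).trans (h i hi).symm⟩

lemma prefixWord_surjective (n : ℕ) : Function.Surjective (prefixWord n) := by
  intro v
  refine ⟨fun i => if h : i < n then v ⟨i, h⟩ else 1, ?_⟩
  ext i
  simp [prefixWord]

lemma measurable_shift : Measurable shift := measurable_pi_lambda _ fun _ => measurable_pi_apply _

lemma shift_iterate (n : ℕ) (ω : ℕ → ℕ+) : shift^[n] ω = fun i => ω (n + i) := by
  induction n generalizing ω with
  | zero => simp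
  | succ n ih =>
    rw [Function.iterate_succ_apply, ih]
    ext i
    simp only [shift]
    rw [Nat.add_right_comm, Nat.add_assoc]

/-- A family of inequalities between the measures of all cylinders of a fixed length extends to
the σ-algebra they generate. -/
lemma measure_preimage_prefixWord_le {μ ν : Measure (ℕ → ℕ+)} {c : ENNReal} {n : ℕ}
    (h : ∀ τ, μ (cylinder τ n) ≤ c * ν (cylinder τ n)) (S : Set (Fin n → ℕ+)) :
    μ (prefixWord n ⁻¹' S) ≤ c * ν (prefixWord n ⁻¹' S) := by
  have hS : MeasurableSet S := S.to_countable.measurableSet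
  have hm := measurable_prefixWord n
  rw [← Measure.map_apply hm hS, ← Measure.map_apply hm hS,
    ← Measure.tsum_indicator_apply_singleton _ _ hS, ← Measure.tsum_indicator_apply_singleton _ _ hS,
    ← ENNReal.tsum_mul_left]
  refine ENNReal.tsum_le_tsum fun v => ?_
  by_cases hv : v ∈ S
  · obtain ⟨τ, rfl⟩ := prefixWord_surjective n v
    simp only [hv, indicator_of_mem]
    rw [Measure.map_apply hm (measurableSet_singleton _),
      Measure.map_apply hm (measurableSet_singleton _), ← cylinder_eq_preimage]
    exact h τ
  · simp [hv]

lemma exists_cylinder_subset {U : Set (ℕ → ℕ+)} (hU : IsOpen U) {ω : ℕ → ℕ+} (hω : ω ∈ U) :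
    ∃ n, cylinder ω n ⊆ U := by
  obtain ⟨I, u, hu, hsub⟩ := isOpen_pi_iff.1 hU ω hω
  obtain ⟨n, hn⟩ := I.exists_nat_subset_range
  refine ⟨n, fun ρ hρ => hsub fun i hi => ?_⟩
  rw [hρ i (Finset.mem_range.1 (hn hi))]
  exact (hu i hi).2

/-- A family of inequalities between the measures of all nontrivial cylinders extends to all
measurable sets. -/
lemma measure_le_of_cylinder {μ ν : Measure (ℕ → ℕ+)} [IsFiniteMeasure ν]
    {c : ENNReal} (hc : c ≠ ⊤) (h : ∀ n, 1 ≤ n → ∀ τ, μ (cylinder τ n) ≤ c * ν (cylinder τ n))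
    (A : Set (ℕ → ℕ+)) : μ A ≤ c * ν A := by
  have hopen : ∀ U : Set (ℕ → ℕ+), IsOpen U → μ U ≤ c * ν U := by
    intro U hU
    -- An open set is the increasing union of the cylinders of length `n` that it contains; lengths
    -- are shifted by one below since only positive lengths are controlled.
    let S : ∀ n, Set (Fin n → ℕ+) := fun n => {v | prefixWord n ⁻¹' {v} ⊆ U}
    have hmem : ∀ n ω, ω ∈ prefixWord n ⁻¹' S n ↔ cylinder ω n ⊆ U := fun n ω => by
      rw [cylinder_eq_preimage]; rfl
    have hmono : Monotone fun n => prefixWord (n + 1) ⁻¹' S (n + 1) := by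
      intro m n hmn ω hω
      simp only [hmem] at hω ⊢
      exact (cylinder_anti ω (Nat.succ_le_succ hmn)).trans hω
    have hun : U = ⋃ n, prefixWord (n + 1) ⁻¹' S (n + 1) := by
      ext ω
      simp only [mem_iUnion, hmem]
      constructor
      · intro hω
        obtain ⟨n, hn⟩ := exists_cylinder_subset hU hω
        exact ⟨n, (cylinder_anti ω n.le_succ).trans hn⟩
      · rintro ⟨n, hn⟩
        exact hn (self_mem_cylinder _ _)
    rw [hun, hmono.measure_iUnion]
    refine iSup_le fun n => (measure_preimage_prefixWord_le (h _ n.succ_pos) _).trans ?_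
    gcongr
    exact subset_iUnion (fun n => prefixWord (n + 1) ⁻¹' S (n + 1)) n
  refine ENNReal.le_of_forall_pos_le_add fun ε hε _ => ?_
  have hc1 : c + 1 ≠ ⊤ := ENNReal.add_ne_top.2 ⟨hc, ENNReal.one_ne_top⟩
  -- Outer regularity of `ν` passes from open sets to all sets; `c + 1` avoids dividing by zero when
  -- `c = 0`.
  obtain ⟨U, hAU, hU, hνU⟩ := A.exists_isOpen_le_add ν (ε := ε / (c + 1))
    (ENNReal.div_ne_zero.2 ⟨by exact_mod_cast hε.ne', hc1⟩)
  calc μ A ≤ c * ν U := (measure_mono hAU).trans (hopen U hU)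
    _ ≤ c * (ν A + ε / (c + 1)) := by gcongr
    _ ≤ c * ν A + (c + 1) * (ε / (c + 1)) := by rw [mul_add]; gcongr; exact le_self_add
    _ = c * ν A + ε := by rw [ENNReal.mul_div_cancel (by simp) hc1]

/-- The sequence whose first `n` letters are those of `τ`, followed by `ρ`. -/
def concat (n : ℕ) (τ ρ : ℕ → ℕ+) : ℕ → ℕ+ := fun i => if i < n then τ i else ρ (i - n)

lemma shift_iterate_concat (n : ℕ) (τ ρ : ℕ → ℕ+) : shift^[n] (concat n τ ρ) = ρ := by
  rw [shift_iterate]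
  ext i
  simp [concat]

lemma cylinder_concat (n : ℕ) (τ ρ : ℕ → ℕ+) : cylinder (concat n τ ρ) n = cylinder τ n :=
  cylinder_congr fun i hi => by simp [concat, hi]

lemma cylinder_concat_add (n m : ℕ) (τ ρ : ℕ → ℕ+) :
    cylinder (concat n τ ρ) (n + m) = cylinder τ n ∩ shift^[n] ⁻¹' cylinder ρ m := by
  ext ω
  simp only [cylinder, mem_ofPred_eq, mem_inter_iff, mem_preimage, shift_iterate]
  constructor
  · intro h
    refine ⟨fun i hi => ?_, fun i hi => ?_⟩
    · rw [h i (by omega)]; simp [concat, hi]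
    · rw [h (n + i) (by omega)]; simp [concat]
  · rintro ⟨h1, h2⟩ i hi
    by_cases hin : i < n
    · rw [h1 i hin]; simp [concat, hin]
    · have := h2 (i - n) (by omega)
      rw [Nat.add_sub_cancel' (by omega)] at this
      rw [this]; simp [concat, hin]

/-! ### Gibbs states on the one-sided shift -/

section Gibbs

variable {ψ : (ℕ → ℕ+) → ℝ} {μ : Measure (ℕ → ℕ+)}

/-- The defining estimate of a Gibbs state with given constants `C` and `P`. -/
def GibbsBound (ψ : (ℕ → ℕ+) → ℝ) (μ : Measure (ℕ → ℕ+)) (C P : ℝ) : Prop :=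
  ∀ n : ℕ, 1 ≤ n → ∀ τ : ℕ → ℕ+,
    μ.real (cylinder τ n) ≤ C * Real.exp (birkhoffSum shift ψ n τ - P * n) ∧
      Real.exp (birkhoffSum shift ψ n τ - P * n) ≤ C * μ.real (cylinder τ n)

lemma div_bounds_iff {C a b : ℝ} (hC : 0 < C) (hb : 0 < b) :
    (C⁻¹ ≤ a / b ∧ a / b ≤ C) ↔ (a ≤ C * b ∧ b ≤ C * a) := by
  rw [and_comm, div_le_iff₀ hb, le_div_iff₀ hb, inv_mul_le_iff₀ hC]

lemma IsGibbsState.exists_gibbsBound (h : IsGibbsState ψ μ) :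
    ∃ C, 1 ≤ C ∧ ∃ P, GibbsBound ψ μ C P := by
  obtain ⟨-, -, C, hC, P, hP⟩ := h
  exact ⟨C, hC, P, fun n hn τ =>
    (div_bounds_iff (zero_lt_one.trans_le hC) (Real.exp_pos _)).1 (hP n hn τ)⟩

lemma GibbsBound.real_cylinder_pos {C P : ℝ} (h : GibbsBound ψ μ C P) (hC : 0 < C)
    {n : ℕ} (hn : 1 ≤ n) (τ : ℕ → ℕ+) : 0 < μ.real (cylinder τ n) :=
  pos_of_mul_pos_right ((Real.exp_pos _).trans_le (h n hn τ).2) hC.le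

/-- Gibbs states are quasi-multiplicative on cylinders. -/
lemma GibbsBound.mul_cylinder_le {C P : ℝ} (h : GibbsBound ψ μ C P) (hC : 0 < C)
    {n m : ℕ} (hn : 1 ≤ n) (hm : 1 ≤ m) (τ ρ : ℕ → ℕ+) :
    μ.real (cylinder τ n) * μ.real (cylinder ρ m) ≤
      C ^ 3 * μ.real (cylinder τ n ∩ shift^[n] ⁻¹' cylinder ρ m) := by
  have h1 := (h n hn (concat n τ ρ)).1
  have h2 := (h m hm ρ).1
  have h3 := (h (n + m) (by omega) (concat n τ ρ)).2
  rw [cylinder_concat] at h1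
  rw [cylinder_concat_add, birkhoffSum_add, shift_iterate_concat] at h3
  calc μ.real (cylinder τ n) * μ.real (cylinder ρ m)
      ≤ (C * Real.exp (birkhoffSum shift ψ n (concat n τ ρ) - P * n)) *
        (C * Real.exp (birkhoffSum shift ψ m ρ - P * m)) := by gcongr
    _ = C ^ 2 * Real.exp (birkhoffSum shift ψ n (concat n τ ρ) + birkhoffSum shift ψ m ρ
          - P * (n + m : ℕ)) := by
        rw [mul_mul_mul_comm, ← Real.exp_add]
        push_cast
        ring_nf
    _ ≤ C ^ 2 * (C * μ.real (cylinder τ n ∩ shift^[n] ⁻¹' cylinder ρ m)) := by gcongr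
    _ = _ := by ring

/-- For a fixed first cylinder both sides are finite measures in `B`, so quasi-multiplicativity
extends from cylinders `B`. -/
lemma GibbsBound.mul_measure_le [IsProbabilityMeasure μ] {C P : ℝ} (h : GibbsBound ψ μ C P)
    (hC : 0 < C) {n : ℕ} (hn : 1 ≤ n) (τ : ℕ → ℕ+) {B : Set (ℕ → ℕ+)} (hB : MeasurableSet B) :
    μ (cylinder τ n) * μ B ≤ ENNReal.ofReal (C ^ 3) * μ (cylinder τ n ∩ shift^[n] ⁻¹' B) := by
  have hsm : Measurable (shift^[n]) := measurable_shift.iterate n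
  have happ : ∀ {B}, MeasurableSet B → ((μ.restrict (cylinder τ n)).map shift^[n]) B =
      μ (cylinder τ n ∩ shift^[n] ⁻¹' B) := fun {B} hB => by
    rw [Measure.map_apply hsm hB, Measure.restrict_apply (hsm hB), inter_comm]
  have := measure_le_of_cylinder (μ := μ (cylinder τ n) • μ)
    (ν := (μ.restrict (cylinder τ n)).map shift^[n]) (c := ENNReal.ofReal (C ^ 3))
    ENNReal.ofReal_ne_top (fun m hm ρ => by
      rw [happ (measurableSet_cylinder _ _), Measure.smul_apply, smul_eq_mul,
        ← ofReal_measureReal, ← ofReal_measureReal, ← ofReal_measureReal,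
        ← ENNReal.ofReal_mul measureReal_nonneg, ← ENNReal.ofReal_mul (by positivity)]
      exact ENNReal.ofReal_le_ofReal (h.mul_cylinder_le hC hn hm τ ρ)) B
  rwa [happ hB, Measure.smul_apply, smul_eq_mul] at this

lemma iterate_preimage_eq {f : (ℕ → ℕ+) → (ℕ → ℕ+)} {B : Set (ℕ → ℕ+)} (h : f ⁻¹' B = B) (n : ℕ) :
    f^[n] ⁻¹' B = B := by
  induction n with
  | zero => rfl
  | succ n ih => rw [Function.iterate_succ', preimage_comp, h, ih]

theorem IsGibbsState.ergodic (h : IsGibbsState ψ μ) : Ergodic shift μ := by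
  have := h.1
  obtain ⟨C, hC, P, hb⟩ := h.exists_gibbsBound
  have hC0 : 0 < C := zero_lt_one.trans_le hC
  refine ⟨h.2.1, ⟨fun B hB hinv => ?_⟩⟩
  -- By invariance of `B`, the inequality `μ B * μ A ≤ C ^ 3 * μ (A ∩ B)` holds for cylinders, hence
  -- for every `A`; it is used at `A = Bᶜ`.
  have key := measure_le_of_cylinder (μ := μ B • μ) (ν := μ.restrict B)
    (c := ENNReal.ofReal (C ^ 3)) ENNReal.ofReal_ne_top (fun n hn τ => by
      have := hb.mul_measure_le hC0 hn τ hB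
      rwa [iterate_preimage_eq hinv, mul_comm, ← Measure.restrict_apply
        (measurableSet_cylinder _ _)] at this) Bᶜ
  rw [Measure.restrict_apply hB.compl, compl_inter_self, measure_empty, mul_zero,
    Measure.smul_apply, smul_eq_mul, nonpos_iff_eq_zero, mul_eq_zero] at key
  rw [eventuallyConst_set']
  rcases key with h0 | h0
  · exact Or.inl (ae_eq_empty.2 h0)
  · exact Or.inr (ae_eq_univ.2 h0)

/-- The pressure constants of two Gibbs states of the same potential are comparable. -/
lemma GibbsBound.le_of_gibbsBound {ν : Measure (ℕ → ℕ+)} [IsProbabilityMeasure μ]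
    [IsProbabilityMeasure ν] {C P D Q : ℝ} (h : GibbsBound ψ μ C P) (h' : GibbsBound ψ ν D Q)
    (hC : 0 < C) (hD : 0 < D) : P ≤ Q := by
  have key : ∀ n : ℕ, 1 ≤ n → 1 ≤ C * D * Real.exp ((Q - P) * n) := by
    intro n hn
    -- Summing the cylinder estimates over all words of length `n` compares the two total masses,
    -- both equal to 1.
    have := measure_preimage_prefixWord_le (μ := μ) (ν := ν) (n := n)
      (c := ENNReal.ofReal (C * D * Real.exp ((Q - P) * n))) (fun τ => by
        rw [← ofReal_measureReal, ← ofReal_measureReal, ← ENNReal.ofReal_mul (by positivity)]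
        refine ENNReal.ofReal_le_ofReal ((h n hn τ).1.trans ?_)
        have h2 := (h' n hn τ).2
        calc C * Real.exp (birkhoffSum shift ψ n τ - P * n)
            = C * Real.exp ((Q - P) * n) * Real.exp (birkhoffSum shift ψ n τ - Q * n) := by
              rw [mul_assoc, ← Real.exp_add]; ring_nf
          _ ≤ C * Real.exp ((Q - P) * n) * (D * ν.real (cylinder τ n)) := by gcongr
          _ = _ := by ring) univ
    rw [preimage_univ, measure_univ, measure_univ, mul_one, ENNReal.one_le_ofReal] at this
    exact this
  by_contra! hlt
  have hlim : Tendsto (fun n : ℕ => C * D * Real.exp ((Q - P) * n)) atTop (𝓝 (C * D * 0)) := by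
    refine (Real.tendsto_exp_atBot.comp ?_).const_mul _
    exact tendsto_natCast_atTop_atTop.const_mul_atTop_of_neg (by linarith)
  have := ge_of_tendsto hlim ((eventually_ge_atTop 1).mono key)
  linarith

theorem IsGibbsState.eq {ν : Measure (ℕ → ℕ+)} (h : IsGibbsState ψ μ) (h' : IsGibbsState ψ ν) :
    ν = μ := by
  have := h.1
  have := h'.1
  obtain ⟨C, hC, P, hb⟩ := h.exists_gibbsBound
  obtain ⟨D, hD, Q, hb'⟩ := h'.exists_gibbsBound
  have hC0 : 0 < C := zero_lt_one.trans_le hC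
  have hD0 : 0 < D := zero_lt_one.trans_le hD
  obtain rfl : P = Q :=
    le_antisymm (hb.le_of_gibbsBound hb' hC0 hD0) (hb'.le_of_gibbsBound hb hD0 hC0)
  refine h.ergodic.eq_of_absolutelyContinuous h'.2.1 (Measure.AbsolutelyContinuous.mk
    fun A _ hA => ?_)
  have := measure_le_of_cylinder (μ := ν) (ν := μ) (c := ENNReal.ofReal (D * C))
    ENNReal.ofReal_ne_top (fun n hn τ => by
      rw [← ofReal_measureReal, ← ofReal_measureReal, ← ENNReal.ofReal_mul (by positivity)]
      refine ENNReal.ofReal_le_ofReal ((hb' n hn τ).1.trans ?_)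
      rw [mul_assoc]
      gcongr
      exact (hb n hn τ).2) A
  rw [hA, mul_zero] at this
  exact nonpos_iff_eq_zero.1 this

/-- The measures of cylinders of a Gibbs state decay exponentially. -/
lemma IsGibbsState.exists_cylinder_le_pow (h : IsGibbsState ψ μ) :
    ∃ δ : ℝ, 0 ≤ δ ∧ δ < 1 ∧ ∀ n τ, μ.real (cylinder τ (n + 1)) ≤ δ ^ n := by
  have := h.1
  obtain ⟨C, hC, P, hb⟩ := h.exists_gibbsBound
  have hC0 : 0 < C := zero_lt_one.trans_le hC
  set p := min (μ.real (cylinder (fun _ => 1) 1)) (μ.real (cylinder (fun _ => 2) 1)) with hp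
  have hp0 : 0 < p := lt_min (hb.real_cylinder_pos hC0 le_rfl _) (hb.real_cylinder_pos hC0 le_rfl _)
  have hp1 : p ≤ 1 := (min_le_left _ _).trans measureReal_le_one
  have hC3 : 1 ≤ C ^ 3 := one_le_pow₀ hC
  refine ⟨1 - p / C ^ 3, ?_, by have : 0 < p / C ^ 3 := by positivity
                                linarith, ?_⟩
  · rw [sub_nonneg, div_le_one (by positivity)]; linarith
  intro n τ
  induction n with
  | zero => simp
  | succ n ih =>
    -- One of the letters 1 and 2 differs from the next letter of `τ`. Continuing with it uses up a
    -- fraction at least `p / C ^ 3` of the cylinder, whatever its length.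
    obtain ⟨k, hk, hpk⟩ : ∃ k : ℕ+, k ≠ τ (n + 1) ∧ p ≤ μ.real (cylinder (fun _ => k) 1) := by
      by_cases h1 : τ (n + 1) = 1
      · exact ⟨2, by rw [h1]; decide, min_le_right _ _⟩
      · exact ⟨1, fun h => h1 h.symm, min_le_left _ _⟩
    have h1 := hb.mul_cylinder_le hC0 (n := n + 1) le_add_self le_rfl τ (fun _ => k)
    set B := cylinder τ (n + 1) ∩ shift^[n + 1] ⁻¹' cylinder (fun _ => k) 1 with hB
    have hBm : MeasurableSet B := (measurableSet_cylinder _ _).inter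
      (measurable_shift.iterate _ (measurableSet_cylinder _ _))
    have hdisj : Disjoint (cylinder τ (n + 1 + 1)) B := by
      rw [disjoint_left]
      rintro ω hω ⟨-, hω2⟩
      have h3 : ω (n + 1) = τ (n + 1) := hω (n + 1) (by omega)
      have h4 : ω (n + 1) = k := by
        have := hω2 0 one_pos
        rwa [shift_iterate] at this
      exact hk (h4.symm.trans h3)
    have h2 : μ.real (cylinder τ (n + 1 + 1)) + μ.real B ≤ μ.real (cylinder τ (n + 1)) := by
      rw [← measureReal_union hdisj hBm]
      exact measureReal_mono (union_subset (cylinder_anti _ (Nat.le_succ _)) inter_subset_left)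
    have h3 : μ.real (cylinder τ (n + 1)) * p / C ^ 3 ≤ μ.real B := by
      rw [div_le_iff₀' (by positivity)]
      exact (mul_le_mul_of_nonneg_left hpk measureReal_nonneg).trans h1
    calc μ.real (cylinder τ (n + 1 + 1)) ≤ μ.real (cylinder τ (n + 1)) * (1 - p / C ^ 3) := by
          rw [mul_sub, mul_one, mul_div_assoc'] ; linarith
      _ ≤ (1 - p / C ^ 3) ^ n * (1 - p / C ^ 3) := by
          gcongr
          rw [sub_nonneg, div_le_one (by positivity)]; linarith
      _ = _ := (pow_succ _ _).symm

end Gibbs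

/-! ### The two-sided shift -/

lemma measurable_shiftZ : Measurable shiftZ :=
  measurable_pi_lambda _ fun _ => measurable_pi_apply _

lemma measurable_future : Measurable future :=
  measurable_pi_lambda _ fun _ => measurable_pi_apply _

lemma measurable_past : Measurable past :=
  measurable_pi_lambda _ fun _ => measurable_pi_apply _

lemma future_shiftZ (τ : ℤ → ℕ+) : future (shiftZ τ) = shift (future τ) := by
  ext n
  simp [future, shiftZ, shift]

lemma shiftZ_iterate (n : ℕ) (τ : ℤ → ℕ+) : shiftZ^[n] τ = fun i => τ (i + n) := by
  induction n generalizing τ with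
  | zero => simp
  | succ n ih =>
    rw [Function.iterate_succ_apply, ih]
    ext i
    simp only [shiftZ]
    congr 1
    push_cast
    ring

lemma cylinderZ_eq_preimage (τ : ℤ → ℕ+) (n : ℕ) :
    cylinderZ τ n = future ⁻¹' cylinder (future τ) n := rfl

lemma measurableSet_cylinderZ (τ : ℤ → ℕ+) (n : ℕ) : MeasurableSet (cylinderZ τ n) :=
  measurable_future (measurableSet_cylinder _ _)

lemma future_surjective : Function.Surjective future := by
  intro ω
  refine ⟨fun i => ω i.toNat, ?_⟩
  ext n
  simp [future]

lemma birkhoffSum_future (ψ : (ℕ → ℕ+) → ℝ) (n : ℕ) (τ : ℤ → ℕ+) :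
    birkhoffSum shiftZ (fun τ => ψ (future τ)) n τ = birkhoffSum shift ψ n (future τ) := by
  induction n generalizing τ with
  | zero => simp
  | succ n ih => rw [birkhoffSum_succ', birkhoffSum_succ', ih, future_shiftZ]

lemma measurePreserving_map_future {μ : Measure (ℤ → ℕ+)} (h : MeasurePreserving shiftZ μ μ) :
    MeasurePreserving shift (μ.map future) (μ.map future) :=
  MeasurePreserving.of_semiconj ⟨measurable_future, rfl⟩ h (fun τ => future_shiftZ τ)
    measurable_shift

lemma IsGibbsStateZ.map_future {ψ : (ℕ → ℕ+) → ℝ} {μ : Measure (ℤ → ℕ+)}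
    (h : IsGibbsStateZ (fun τ => ψ (future τ)) μ) : IsGibbsState ψ (μ.map future) := by
  obtain ⟨h1, h2, C, hC, P, hP⟩ := h
  refine ⟨Measure.isProbabilityMeasure_map measurable_future.aemeasurable,
    measurePreserving_map_future h2, C, hC, P, fun n hn ω => ?_⟩
  obtain ⟨τ, rfl⟩ := future_surjective ω
  rw [map_measureReal_apply measurable_future (measurableSet_cylinder _ _),
    ← cylinderZ_eq_preimage, ← birkhoffSum_future]
  exact hP n hn τ

/-- A shift-invariant measure on the two-sided shift is determined by its image on the one-sided
shift. -/
lemma eq_of_map_future_eq {μ ν : Measure (ℤ → ℕ+)} [IsProbabilityMeasure μ]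
    [IsProbabilityMeasure ν] (hμ : MeasurePreserving shiftZ μ μ) (hν : MeasurePreserving shiftZ ν ν)
    (h : μ.map future = ν.map future) : μ = ν := by
  -- Invariance moves any finite set of coordinates into the nonnegative ones, so every
  -- finite-dimensional marginal is read off from the future.
  have key : ∀ {μ : Measure (ℤ → ℕ+)}, MeasurePreserving shiftZ μ μ → ∀ (I : Finset ℤ) (m : ℕ),
      (∀ i ∈ I, 0 ≤ i + m) → μ.map I.restrict = (μ.map future).map
        fun ω (i : I) => ω ((i : ℤ) + m).toNat := by
    intro μ hμ I m hm
    have hr : Measurable fun (ω : ℕ → ℕ+) (i : I) => ω ((i : ℤ) + m).toNat :=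
      measurable_pi_lambda _ fun _ => measurable_pi_apply _
    rw [Measure.map_map hr measurable_future]
    conv_lhs => rw [← (hμ.iterate m).map_eq]
    rw [Measure.map_map (Finset.measurable_restrict I) (measurable_shiftZ.iterate m)]
    congr 1
    ext τ i
    simp [shiftZ_iterate, future, hm i i.2]
  refine IsProjectiveLimit.unique (P := fun I : Finset ℤ => ν.map I.restrict) (fun I => ?_)
    fun I => rfl
  obtain ⟨m, hm⟩ : ∃ m : ℕ, ∀ i ∈ I, 0 ≤ i + m := by
    refine ⟨I.sup Int.natAbs, fun i hi => ?_⟩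
    have := Finset.le_sup (f := Int.natAbs) hi
    omega
  exact (key hμ I m hm).trans (by rw [h, ← key hν I m hm])

lemma IsGibbsStateZ.eq {ψ : (ℕ → ℕ+) → ℝ} {μ ν : Measure (ℤ → ℕ+)}
    (hμ : IsGibbsStateZ (fun τ => ψ (future τ)) μ) (hν : IsGibbsStateZ (fun τ => ψ (future τ)) ν) :
    ν = μ := by
  have := hμ.1
  have := hν.1
  exact eq_of_map_future_eq hν.2.1 hμ.2.1 (hμ.map_future.eq hν.map_future)

/-! ### Non-atomicity of futures and pasts -/

lemma measureReal_future_fiber {μ : Measure (ℤ → ℕ+)} {ψ : (ℕ → ℕ+) → ℝ}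
    (h : IsGibbsState ψ (μ.map future)) (ω : ℕ → ℕ+) : μ.real {τ | future τ = ω} = 0 := by
  have := h.1
  have hfin : IsFiniteMeasure μ := by
    refine ⟨?_⟩
    have := measure_lt_top (μ.map future) univ
    rwa [Measure.map_apply measurable_future .univ] at this
  obtain ⟨δ, h0, h1, hδ⟩ := h.exists_cylinder_le_pow
  refine le_antisymm (ge_of_tendsto' (tendsto_pow_atTop_nhds_zero_of_lt_one h0 h1) fun n => ?_)
    measureReal_nonneg
  refine le_trans ?_ (hδ n ω)
  rw [map_measureReal_apply measurable_future (measurableSet_cylinder _ _)]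
  refine measureReal_mono fun τ hτ => ?_
  rw [mem_preimage, show future τ = ω from hτ]
  exact self_mem_cylinder _ _

lemma measureReal_past_fiber {μ : Measure (ℤ → ℕ+)} [IsProbabilityMeasure μ]
    (hμ : MeasurePreserving shiftZ μ μ) {ψ : (ℕ → ℕ+) → ℝ}
    (h : IsGibbsState ψ (μ.map future)) (ω : ℕ → ℕ+) : μ.real {τ | past τ = ω} = 0 := by
  obtain ⟨δ, h0, h1, hδ⟩ := h.exists_cylinder_le_pow
  refine le_antisymm (ge_of_tendsto' (tendsto_pow_atTop_nhds_zero_of_lt_one h0 h1) fun n => ?_)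
    measureReal_nonneg
  -- Shifted by `n + 1`, the last `n + 1` letters of the past become the reversed word at positions
  -- `0, …, n`; truncated subtraction affects only indices beyond it.
  refine le_trans ?_ (hδ n fun i => ω (n - i))
  rw [map_measureReal_apply measurable_future (measurableSet_cylinder _ _)]
  have hit := hμ.iterate (n + 1)
  have hs : {τ | past τ = ω} ⊆
      {τ : ℤ → ℕ+ | (fun i : ℕ => τ (-((i : ℤ) + 1))) ∈ cylinder ω (n + 1)} := by
    rintro τ rfl
    exact self_mem_cylinder _ _
  refine (measureReal_mono hs).trans (le_of_eq ?_)
  have hpm : MeasurableSet {τ : ℤ → ℕ+ | (fun i : ℕ => τ (-((i : ℤ) + 1))) ∈ cylinder ω (n + 1)} :=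
    measurable_past (measurableSet_cylinder _ _)
  rw [← hit.measureReal_preimage hpm.nullMeasurableSet]
  congr 1
  ext τ
  simp only [mem_preimage, mem_ofPred_eq, shiftZ_iterate, cylinder, future]
  constructor
  · intro H i hi
    rw [← H (n - i) (by omega)]
    congr 1
    push_cast [Nat.cast_sub (show i ≤ n by omega)]
    ring
  · intro H i hi
    have := H (n - i) (by omega)
    rw [Nat.sub_sub_self (by omega)] at this
    rw [← this]
    congr 1
    push_cast [Nat.cast_sub (show i ≤ n by omega)]
    ring

/-! ### The coding map and the Gauss map -/

lemma cfFin_mem {l : List ℕ} (hl : ∀ a ∈ l, 1 ≤ a) : cfFin l ∈ Icc (0 : ℝ) 1 :=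
  foldr_branch_mem l hl (by simp)

lemma coding_mem_Icc (ω : ℕ → ℕ+) : coding ω ∈ Icc (0 : ℝ) 1 := by
  refine isClosed_Icc.mem_of_tendsto (tendsto_cf fun i => (ω i).pos)
    (Eventually.of_forall fun n => cfFin_mem fun a ha => ?_)
  obtain ⟨i, -, rfl⟩ := List.mem_map.1 ha
  exact (ω i).pos

lemma one_le_coe (k : ℕ+) : (1 : ℝ) ≤ ((k : ℕ) : ℝ) := by exact_mod_cast k.pos

lemma coding_eq_branch (ω : ℕ → ℕ+) : coding ω = branch (ω 0) (coding (shift ω)) := by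
  have h1 := (tendsto_cf (w := fun i => (ω i : ℕ)) fun i => (ω i).pos).comp (tendsto_add_atTop_nat 1)
  have h2 := tendsto_cf (w := fun i => (shift ω i : ℕ)) fun i => (shift ω i).pos
  have h3 : ((ω 0 : ℕ) : ℝ) + coding (shift ω) ≠ 0 := by
    linarith [(coding_mem_Icc (shift ω)).1, one_le_coe (ω 0)]
  refine tendsto_nhds_unique h1 ((tendsto_const_nhds.div (h2.const_add ((ω 0 : ℕ) : ℝ)) h3).congr fun n => ?_)
  simp only [Function.comp_apply, List.range_succ_eq_map, List.map_cons, List.map_map, cfFin,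
    List.foldr_cons]
  rfl

lemma coding_pos (ω : ℕ → ℕ+) : 0 < coding ω := by
  rw [coding_eq_branch, branch]
  have := (coding_mem_Icc (shift ω)).1
  have := one_le_coe (ω 0)
  positivity

lemma coding_lt_one (ω : ℕ → ℕ+) : coding ω < 1 := by
  rw [coding_eq_branch, branch]
  have := coding_pos (shift ω)
  have := one_le_coe (ω 0)
  rw [div_lt_one (by linarith)]
  linarith

lemma one_div_coding (ω : ℕ → ℕ+) : 1 / coding ω = (ω 0 : ℕ) + coding (shift ω) := by
  rw [coding_eq_branch, branch, one_div_one_div]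

lemma gaussMap_coding (ω : ℕ → ℕ+) : gaussMap (coding ω) = coding (shift ω) := by
  rw [gaussMap, one_div_coding, Int.fract_natCast_add, Int.fract_eq_self]
  exact ⟨(coding_pos _).le, coding_lt_one _⟩

lemma gaussMap_iterate_coding (k : ℕ) (ω : ℕ → ℕ+) :
    gaussMap^[k] (coding ω) = coding (shift^[k] ω) := by
  induction k generalizing ω with
  | zero => rfl
  | succ k ih => rw [Function.iterate_succ_apply, gaussMap_coding, ih, Function.iterate_succ_apply]

lemma digit_coding (ω : ℕ → ℕ+) (k : ℕ) : digit (coding ω) k = ω k := by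
  rw [digit, gaussMap_iterate_coding, one_div_coding, shift_iterate,
    add_comm, Nat.floor_add_natCast (coding_pos _).le, Nat.floor_eq_zero.2 (coding_lt_one _)]
  simp

lemma coding_injective : Function.Injective coding := by
  intro ω ρ h
  funext k
  exact PNat.coe_injective (by rw [← digit_coding ω, h, digit_coding])

/-- An embedding transports almost-everywhere statements without any measurability check on the
exceptional set. -/
lemma measurableEmbedding_coding : MeasurableEmbedding coding :=
  measurable_coding.measurableEmbedding coding_injective

lemma T_coding (k : ℕ) (ω : ℕ → ℕ+) : T k (coding ω) = coding (shift^[k] ω) := by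
  simp only [T, digit_coding]
  simp only [coding, shift_iterate]

/-- The finite continued fraction `[ω_{m-1}, …, ω₀]` of the reversed first `m` letters. -/
noncomputable def revCoding (m : ℕ) (ω : ℕ → ℕ+) : ℝ :=
  cfFin ((List.range m).map fun i => (ω i : ℕ)).reverse

lemma V_coding (k : ℕ) (ω : ℕ → ℕ+) : V k (coding ω) = revCoding k ω := by
  simp only [V, revCoding, ← digit_coding ω]

lemma cfFin_append (l l' : List ℕ) : cfFin (l ++ l') = l.foldr branch (cfFin l') := by
  simp [cfFin, List.foldr_append]

lemma abs_foldr_branch_sub_le {l : List ℕ} (hl : ∀ a ∈ l, 1 ≤ a) {x y : ℝ}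
    (hx : x ∈ Icc (0 : ℝ) 1) (hy : y ∈ Icc (0 : ℝ) 1) :
    |l.foldr branch x - l.foldr branch y| ≤ 2 * (1 / 2) ^ l.length := by
  refine (foldr_branch_sub l hl hx hy).trans (mul_le_of_le_one_right (by positivity) ?_)
  rw [abs_le]
  constructor <;> linarith [hx.1, hx.2, hy.1, hy.2]

/-- Both reversed expansions start with the same `m` digits, and the composition of `m` inverse
branches contracts at this rate. -/
lemma abs_revCoding_sub_le (m k : ℕ) (ω : ℕ → ℕ+) :
    |revCoding (k + m) ω - revCoding m (shift^[k] ω)| ≤ 2 * (1 / 2) ^ m := by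
  have hl : ∀ (f : ℕ → ℕ+) (n : ℕ), ∀ a ∈ ((List.range n).map fun i => (f i : ℕ)).reverse,
      1 ≤ a := by
    intro f n a ha
    obtain ⟨i, -, rfl⟩ := List.mem_map.1 (List.mem_reverse.1 ha)
    exact (f i).pos
  have h1 : revCoding (k + m) ω =
      (((List.range m).map fun i => (shift^[k] ω i : ℕ)).reverse).foldr branch (revCoding k ω) := by
    rw [revCoding, List.range_add, List.map_append, List.reverse_append, cfFin_append, List.map_map]
    simp only [shift_iterate]
    rfl
  have h2 := abs_foldr_branch_sub_le (hl (shift^[k] ω) m) (cfFin_mem (hl ω k))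
    (y := 0) (by simp)
  rw [List.length_reverse, List.length_map, List.length_range] at h2
  rw [h1]
  exact h2

lemma abs_revCoding_sub_coding_past_le (m : ℕ) (τ : ℤ → ℕ+) :
    |revCoding m (future fun i => τ (i - m)) - coding (past τ)| ≤ 2 * (1 / 2) ^ m := by
  set l := ((List.range m).map fun i => (past τ i : ℕ)) with hl_def
  have hl : ∀ (f : ℕ → ℕ+) (n : ℕ), ∀ a ∈ ((List.range n).map fun i => (f i : ℕ)), 1 ≤ a := by
    intro f n a ha
    obtain ⟨i, -, rfl⟩ := List.mem_map.1 ha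
    exact (f i).pos
  have h1 : revCoding m (future fun i => τ (i - m)) = cfFin l := by
    rw [revCoding]
    congr 1
    refine List.ext_getElem (by simp [hl_def]) fun i h1 h2 => ?_
    have hi : i < m := by simpa [hl_def] using h2
    simp only [hl_def, future, past, List.getElem_reverse, List.getElem_map, List.getElem_range,
      List.length_map, List.length_range]
    congr 2
    omega
  have h2 : Tendsto (fun n => cfFin ((List.range n).map fun i => (past τ i : ℕ))) atTop
      (𝓝 (coding (past τ))) := tendsto_cf fun i => (past τ i).pos
  rw [h1]
  refine le_of_tendsto ((h2.const_sub (cfFin l)).abs) ?_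
  filter_upwards [eventually_ge_atTop m] with n hn
  obtain ⟨k, rfl⟩ := Nat.exists_eq_add_of_le hn
  rw [List.range_add, List.map_append, List.map_map, cfFin_append]
  have := abs_foldr_branch_sub_le (hl (past τ) m) (x := 0) (by simp)
    (cfFin_mem (hl (fun i => past τ (m + i)) k))
  rw [List.length_map, List.length_range] at this
  exact this

lemma zeta_eq (s : ℝ) (ω : ℕ → ℕ+) :
    zeta s ω = -(2 * s) * Real.log ((ω 0 : ℕ) + coding (shift ω)) := by
  have hpos : (0 : ℝ) < (ω 0 : ℕ) + coding (shift ω) := by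
    linarith [coding_pos (shift ω), one_le_coe (ω 0)]
  have hd : deriv (branch (ω 0)) (coding (shift ω)) = -(((ω 0 : ℕ) + coding (shift ω)) ^ 2)⁻¹ := by
    have h1 : HasDerivAt (fun y : ℝ => ((ω 0 : ℕ) : ℝ) + y) 1 (coding (shift ω)) :=
      (hasDerivAt_id _).const_add _
    have h2 := h1.inv hpos.ne'
    have h3 : branch (ω 0) = (fun y : ℝ => ((ω 0 : ℕ) : ℝ) + y)⁻¹ := by
      ext y; simp [branch]
    rw [h3, h2.deriv, neg_div, one_div]
  rw [zeta, hd, abs_neg, abs_of_pos (by positivity), Real.log_inv, Real.log_pow]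
  push_cast
  ring

/-! ### Weights of words -/

/-- The matrix of the Möbius map `y ↦ 1 / (k + y)`, up to the order of the coordinates. -/
def letterMat (k : ℕ+) : Matrix (Fin 2) (Fin 2) ℝ := !![((k : ℕ) : ℝ), 1; 1, 0]

/-- The product of the matrices of the letters of a word; its entries are continuants. -/
def wordMat {n : ℕ} (v : Fin n → ℕ+) : Matrix (Fin 2) (Fin 2) ℝ :=
  (List.ofFn fun i => letterMat (v i)).prod

lemma wordMat_zero (v : Fin 0 → ℕ+) : wordMat v = 1 := by simp [wordMat]

lemma wordMat_succ {n : ℕ} (v : Fin (n + 1) → ℕ+) :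
    wordMat v = letterMat (v 0) * wordMat fun i => v i.succ := by
  simp [wordMat, List.ofFn_succ]

lemma wordMat_append {n m : ℕ} (v : Fin n → ℕ+) (w : Fin m → ℕ+) :
    wordMat (Fin.append v w) = wordMat v * wordMat w := by
  rw [wordMat, wordMat, wordMat, ← List.prod_append, ← List.ofFn_fin_append]
  congr 2
  ext1 i
  refine Fin.addCases (fun i => ?_) (fun i => ?_) i <;> simp

/-- Nonnegative matrices in which the upper left entry dominates. -/
structure Dominant (M : Matrix (Fin 2) (Fin 2) ℝ) : Prop where
  one_le : 1 ≤ M 0 0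
  nonneg01 : 0 ≤ M 0 1
  nonneg10 : 0 ≤ M 1 0
  nonneg11 : 0 ≤ M 1 1
  le01 : M 0 1 ≤ M 0 0
  le10 : M 1 0 ≤ M 0 0
  le11 : M 1 1 ≤ M 0 0

lemma dominant_wordMat {n : ℕ} (v : Fin n → ℕ+) : Dominant (wordMat v) := by
  -- Dominance alone is not inductive: comparing the new top row entries when the letter is 1
  -- requires comparing column sums.
  suffices h : Dominant (wordMat v) ∧ wordMat v 0 1 + wordMat v 1 1 ≤ wordMat v 0 0 + wordMat v 1 0
    from h.1
  induction n with
  | zero => rw [wordMat_zero]; exact ⟨⟨by simp, by simp, by simp, by simp, by simp, by simp,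
      by simp⟩, by simp⟩
  | succ n ih =>
    rw [wordMat_succ]
    obtain ⟨⟨h1, h2, h3, h4, h5, h6, h7⟩, h8⟩ := ih fun i => v i.succ
    have hk := one_le_coe (v 0)
    set M := wordMat fun i => v i.succ
    set k : ℝ := ((v 0 : ℕ) : ℝ) with hk_def
    have e00 : (letterMat (v 0) * M) 0 0 = k * M 0 0 + M 1 0 := by
      simp [letterMat, Matrix.mul_apply, Fin.sum_univ_two, hk_def]
    have e01 : (letterMat (v 0) * M) 0 1 = k * M 0 1 + M 1 1 := by
      simp [letterMat, Matrix.mul_apply, Fin.sum_univ_two, hk_def]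
    have e10 : (letterMat (v 0) * M) 1 0 = M 0 0 := by
      simp [letterMat, Matrix.mul_apply, Fin.sum_univ_two]
    have e11 : (letterMat (v 0) * M) 1 1 = M 0 1 := by
      simp [letterMat, Matrix.mul_apply, Fin.sum_univ_two]
    have h9 : 0 ≤ (k - 1) * (M 0 0 - M 0 1) := mul_nonneg (by linarith) (by linarith)
    have h10 : 0 ≤ (k - 1) * M 0 0 := mul_nonneg (by linarith) (by linarith)
    have h11 : 0 ≤ k * M 0 1 := mul_nonneg (by linarith) h2
    refine ⟨⟨?_, ?_, ?_, ?_, ?_, ?_, ?_⟩, ?_⟩ <;> simp only [e00, e01, e10, e11] <;> linarith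

lemma trace_fin_two (M : Matrix (Fin 2) (Fin 2) ℝ) : M.trace = M 0 0 + M 1 1 :=
  Matrix.trace_fin_two M

lemma Dominant.one_le_trace {M : Matrix (Fin 2) (Fin 2) ℝ} (h : Dominant M) : 1 ≤ M.trace := by
  rw [trace_fin_two]; linarith [h.one_le, h.nonneg11]

/-- Each of the four products in the trace is at most `M 0 0 * N 0 0`. -/
lemma Dominant.trace_mul_le {M N : Matrix (Fin 2) (Fin 2) ℝ} (hM : Dominant M) (hN : Dominant N) :
    (M * N).trace ≤ 4 * (M.trace * N.trace) := by
  obtain ⟨h1, h2, h3, h4, h5, h6, h7⟩ := hM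
  obtain ⟨g1, g2, g3, g4, g5, g6, g7⟩ := hN
  simp only [trace_fin_two, Matrix.mul_apply, Fin.sum_univ_two]
  have a1 : M 0 1 * N 1 0 ≤ M 0 0 * N 0 0 := by gcongr
  have a2 : M 1 0 * N 0 1 ≤ M 0 0 * N 0 0 := by gcongr
  have a3 : M 1 1 * N 1 1 ≤ M 0 0 * N 0 0 := by gcongr
  have a4 : M 0 0 * N 0 0 ≤ (M 0 0 + M 1 1) * (N 0 0 + N 1 1) := by gcongr <;> linarith
  linarith

/-- Each trace is at most twice its upper left entry, and the other terms of the product are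
nonnegative. -/
lemma Dominant.mul_trace_le {M N : Matrix (Fin 2) (Fin 2) ℝ} (hM : Dominant M) (hN : Dominant N) :
    M.trace * N.trace ≤ 4 * (M * N).trace := by
  obtain ⟨h1, h2, h3, h4, h5, h6, h7⟩ := hM
  obtain ⟨g1, g2, g3, g4, g5, g6, g7⟩ := hN
  simp only [trace_fin_two, Matrix.mul_apply, Fin.sum_univ_two]
  have a1 : (M 0 0 + M 1 1) * (N 0 0 + N 1 1) ≤ (2 * M 0 0) * (2 * N 0 0) := by
    gcongr <;> linarith
  have a2 : 0 ≤ M 0 1 * N 1 0 := by positivity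
  have a3 : 0 ≤ M 1 0 * N 0 1 := by positivity
  have a4 : 0 ≤ M 1 1 * N 1 1 := by positivity
  linarith

/-- The weight `(tr M_v)^{-2s}` of a word `v`. -/
noncomputable def weight (s : ℝ) {n : ℕ} (v : Fin n → ℕ+) : ℝ := (wordMat v).trace ^ (-(2 * s))

lemma trace_wordMat_pos {n : ℕ} (v : Fin n → ℕ+) : 0 < (wordMat v).trace :=
  zero_lt_one.trans_le (dominant_wordMat v).one_le_trace

lemma weight_pos (s : ℝ) {n : ℕ} (v : Fin n → ℕ+) : 0 < weight s v :=
  Real.rpow_pos_of_pos (trace_wordMat_pos v) _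

/-- The multiplicative error `4^{2s}` in the estimates on weights. -/
noncomputable def distortion (s : ℝ) : ℝ := 4 ^ (2 * s)

lemma one_le_distortion {s : ℝ} (hs : 0 ≤ s) : 1 ≤ distortion s :=
  Real.one_le_rpow (by norm_num) (by linarith)

lemma rpow_neg_le {s a b : ℝ} (hs : 0 ≤ s) (ha : 0 < a) (hb : 0 < b) (h : a ≤ 4 * b) :
    b ^ (-(2 * s)) ≤ distortion s * a ^ (-(2 * s)) := by
  have h1 : (4 * b) ^ (-(2 * s)) ≤ a ^ (-(2 * s)) :=
    Real.rpow_le_rpow_of_nonpos ha h (by linarith)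
  rw [Real.mul_rpow (by norm_num) hb.le, Real.rpow_neg (by norm_num), inv_mul_le_iff₀
    (by positivity)] at h1
  exact h1

lemma weight_append_le {s : ℝ} (hs : 0 ≤ s) {n m : ℕ} (v : Fin n → ℕ+) (w : Fin m → ℕ+) :
    weight s (Fin.append v w) ≤ distortion s * (weight s v * weight s w) := by
  have hv := trace_wordMat_pos v
  have hw := trace_wordMat_pos w
  rw [weight, weight, weight, ← Real.mul_rpow hv.le hw.le]
  refine rpow_neg_le hs (by positivity) (trace_wordMat_pos _) ?_
  rw [wordMat_append]
  exact (dominant_wordMat v).mul_trace_le (dominant_wordMat w)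

lemma weight_mul_le {s : ℝ} (hs : 0 ≤ s) {n m : ℕ} (v : Fin n → ℕ+) (w : Fin m → ℕ+) :
    weight s v * weight s w ≤ distortion s * weight s (Fin.append v w) := by
  have hv := trace_wordMat_pos v
  have hw := trace_wordMat_pos w
  rw [weight, weight, weight, ← Real.mul_rpow hv.le hw.le]
  refine rpow_neg_le hs (trace_wordMat_pos _) (by positivity) ?_
  rw [wordMat_append]
  exact (dominant_wordMat v).trace_mul_le (dominant_wordMat w)

/-- Rotation permutes the matrix factors cyclically. This is why weights use the trace and not the
denominator `M 0 0`: it makes the periodic measures shift-invariant. -/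
lemma weight_rotate (s : ℝ) {N : ℕ} [NeZero N] (v : Fin N → ℕ+) :
    weight s (fun i => v (i + 1)) = weight s v := by
  obtain ⟨n, rfl⟩ := Nat.exists_eq_succ_of_ne_zero (NeZero.ne N)
  have h : wordMat (fun i => v (i + 1)) = wordMat (fun i : Fin n => v i.succ) * letterMat (v 0) := by
    rw [wordMat, wordMat, List.ofFn_succ', List.concat_eq_append, List.prod_append]
    simp
  rw [weight, weight, h, Matrix.trace_mul_comm, ← wordMat_succ]

/-! ### Comparison of the weights with the Birkhoff sums of `zeta` -/

/-- `log (ω₀ + [ω₁, ω₂, …])`. -/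
noncomputable def logDenom (ω : ℕ → ℕ+) : ℝ := Real.log ((ω 0 : ℕ) + coding (shift ω))

lemma birkhoffSum_zeta (s : ℝ) (n : ℕ) (ω : ℕ → ℕ+) :
    birkhoffSum shift (zeta s) n ω = -(2 * s) * birkhoffSum shift logDenom n ω := by
  simp only [birkhoffSum, zeta_eq, logDenom, Finset.mul_sum]

/-- The word matrix sends the vector $(1,[\omega_n,\dots])$ to a multiple of $(1,[\omega_0,\dots])$;
the multipliers form a cocycle, the exponential of the Birkhoff sum of `logDenom`. -/
lemma wordMat_mul_coding (n : ℕ) (ω : ℕ → ℕ+) :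
    wordMat (prefixWord n ω) 0 0 + wordMat (prefixWord n ω) 0 1 * coding (shift^[n] ω) =
        Real.exp (birkhoffSum shift logDenom n ω) ∧
      wordMat (prefixWord n ω) 1 0 + wordMat (prefixWord n ω) 1 1 * coding (shift^[n] ω) =
        Real.exp (birkhoffSum shift logDenom n ω) * coding ω := by
  induction n generalizing ω with
  | zero => simp [wordMat_zero]
  | succ n ih =>
    obtain ⟨h1, h2⟩ := ih (shift ω)
    have hpos : (0 : ℝ) < (ω 0 : ℕ) + coding (shift ω) := by
      linarith [coding_pos (shift ω), one_le_coe (ω 0)]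
    have hM : wordMat (prefixWord (n + 1) ω) =
        letterMat (ω 0) * wordMat (prefixWord n (shift ω)) := wordMat_succ _
    rw [hM, birkhoffSum_succ', Function.iterate_succ_apply, Real.exp_add, logDenom,
      Real.exp_log hpos]
    set M := wordMat (prefixWord n (shift ω))
    have hc : ((ω 0 : ℕ) + coding (shift ω)) * coding ω = 1 := by
      rw [← one_div_coding, one_div_mul_cancel (coding_pos ω).ne']
    constructor
    · simp only [letterMat, Matrix.mul_apply, Fin.sum_univ_two, Matrix.of_apply, Matrix.cons_val',
        Matrix.cons_val_zero, Matrix.cons_val_one, Matrix.cons_val_fin_one]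
      linear_combination ((ω 0 : ℕ) : ℝ) * h1 + h2
    · simp only [letterMat, Matrix.mul_apply, Fin.sum_univ_two, Matrix.of_apply, Matrix.cons_val',
        Matrix.cons_val_zero, Matrix.cons_val_one, Matrix.cons_val_fin_one]
      linear_combination h1 - Real.exp (birkhoffSum shift logDenom n (shift ω)) * hc

/-- The multiplier is `M 0 0 + M 0 1 * t` with `0 ≤ t ≤ 1`, so it and the trace both lie between `M
0 0` and `2 * M 0 0`. -/
lemma weight_bounds {s : ℝ} (hs : 0 ≤ s) (n : ℕ) (ω : ℕ → ℕ+) :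
    weight s (prefixWord n ω) ≤ distortion s * Real.exp (birkhoffSum shift (zeta s) n ω) ∧
      Real.exp (birkhoffSum shift (zeta s) n ω) ≤ distortion s * weight s (prefixWord n ω) := by
  have he : Real.exp (birkhoffSum shift (zeta s) n ω) =
      Real.exp (birkhoffSum shift logDenom n ω) ^ (-(2 * s)) := by
    rw [birkhoffSum_zeta, ← Real.exp_mul, mul_comm]
  have hd := dominant_wordMat (prefixWord n ω)
  have h1 := (wordMat_mul_coding n ω).1
  have ht := trace_fin_two (wordMat (prefixWord n ω))
  have hc := coding_mem_Icc (shift^[n] ω)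
  have h2 : 0 ≤ wordMat (prefixWord n ω) 0 1 * coding (shift^[n] ω) :=
    mul_nonneg hd.nonneg01 hc.1
  have h3 : wordMat (prefixWord n ω) 0 1 * coding (shift^[n] ω) ≤ wordMat (prefixWord n ω) 0 1 :=
    mul_le_of_le_one_right hd.nonneg01 hc.2
  rw [he, weight]
  constructor
  · refine rpow_neg_le hs (Real.exp_pos _) (trace_wordMat_pos _) ?_
    linarith [hd.one_le, hd.nonneg11, hd.le01]
  · refine rpow_neg_le hs (trace_wordMat_pos _) (Real.exp_pos _) ?_
    linarith [hd.one_le, hd.le11]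

/-! ### Partition functions -/

/-- The sum of the weights of all words of length `n`. -/
noncomputable def partition (s : ℝ) (n : ℕ) : ENNReal :=
  ∑' v : Fin n → ℕ+, ENNReal.ofReal (weight s v)

lemma tsum_append (n m : ℕ) (F : (Fin (n + m) → ℕ+) → ENNReal) :
    ∑' v, F v = ∑' (v : Fin n → ℕ+) (w : Fin m → ℕ+), F (Fin.append v w) := by
  rw [← (Fin.appendEquiv n m).tsum_eq, ENNReal.tsum_prod']
  rfl

lemma tsum_weight_append_le {s : ℝ} (hs : 0 ≤ s) {n : ℕ} (m : ℕ) (v : Fin n → ℕ+) :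
    ∑' w : Fin m → ℕ+, ENNReal.ofReal (weight s (Fin.append v w)) ≤
      ENNReal.ofReal (distortion s) * (ENNReal.ofReal (weight s v) * partition s m) := by
  rw [partition, ← ENNReal.tsum_mul_left, ← ENNReal.tsum_mul_left]
  refine ENNReal.tsum_le_tsum fun w => ?_
  rw [← ENNReal.ofReal_mul (weight_pos s v).le,
    ← ENNReal.ofReal_mul (zero_le_one.trans (one_le_distortion hs))]
  exact ENNReal.ofReal_le_ofReal (weight_append_le hs v w)

lemma weight_mul_partition_le {s : ℝ} (hs : 0 ≤ s) {n : ℕ} (m : ℕ) (v : Fin n → ℕ+) :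
    ENNReal.ofReal (weight s v) * partition s m ≤ ENNReal.ofReal (distortion s) *
      ∑' w : Fin m → ℕ+, ENNReal.ofReal (weight s (Fin.append v w)) := by
  rw [partition, ← ENNReal.tsum_mul_left, ← ENNReal.tsum_mul_left]
  refine ENNReal.tsum_le_tsum fun w => ?_
  rw [← ENNReal.ofReal_mul (weight_pos s v).le,
    ← ENNReal.ofReal_mul (zero_le_one.trans (one_le_distortion hs))]
  exact ENNReal.ofReal_le_ofReal (weight_mul_le hs v w)

lemma partition_add_le {s : ℝ} (hs : 0 ≤ s) (n m : ℕ) :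
    partition s (n + m) ≤ ENNReal.ofReal (distortion s) * (partition s n * partition s m) := by
  rw [partition, tsum_append, partition, ← ENNReal.tsum_mul_right, ← ENNReal.tsum_mul_left]
  exact ENNReal.tsum_le_tsum fun v => tsum_weight_append_le hs m v

lemma partition_mul_le {s : ℝ} (hs : 0 ≤ s) (n m : ℕ) :
    partition s n * partition s m ≤ ENNReal.ofReal (distortion s) * partition s (n + m) := by
  rw [partition.eq_1 s (n + m), tsum_append, partition.eq_1 s n, ← ENNReal.tsum_mul_right,
    ← ENNReal.tsum_mul_left]
  exact ENNReal.tsum_le_tsum fun v => weight_mul_partition_le hs m v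

lemma weight_one (s : ℝ) (v : Fin 1 → ℕ+) : weight s v = ((v 0 : ℕ) : ℝ) ^ (-(2 * s)) := by
  simp [weight, wordMat, letterMat]

/-- Here `s > 1/2` is decisive: it yields both finite partition functions and the tails needed for
tightness. -/
lemma tsum_rpow_ne_top {s : ℝ} (hs : 1 / 2 < s) :
    ∑' k : ℕ+, ENNReal.ofReal (((k : ℕ) : ℝ) ^ (-(2 * s))) ≠ ⊤ := by
  have h : Summable fun k : ℕ => (k : ℝ) ^ (-(2 * s)) :=
    Real.summable_nat_rpow.2 (by linarith)
  exact (h.comp_injective PNat.coe_injective).tsum_ofReal_ne_top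

lemma partition_one_ne_top {s : ℝ} (hs : 1 / 2 < s) : partition s 1 ≠ ⊤ := by
  rw [partition, ← (Equiv.funUnique (Fin 1) ℕ+).symm.tsum_eq]
  simp only [weight_one]
  exact tsum_rpow_ne_top hs

lemma partition_zero_ne_top (s : ℝ) : partition s 0 ≠ ⊤ := by
  simp [partition]

lemma partition_ne_top {s : ℝ} (hs : 1 / 2 < s) (n : ℕ) : partition s n ≠ ⊤ := by
  induction n with
  | zero => exact partition_zero_ne_top s
  | succ n ih =>
    exact ne_top_of_le_ne_top (ENNReal.mul_ne_top ENNReal.ofReal_ne_top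
      (ENNReal.mul_ne_top ih (partition_one_ne_top hs))) (partition_add_le (by linarith) n 1)

lemma partition_ne_zero (s : ℝ) (n : ℕ) : partition s n ≠ 0 := by
  refine fun h => ?_
  have := ENNReal.tsum_eq_zero.1 h fun _ => 1
  rw [ENNReal.ofReal_eq_zero] at this
  exact absurd this (not_le.2 (weight_pos s _))

/-- A positive sequence which is multiplicative up to a constant factor is comparable with a
geometric sequence. -/
lemma exists_exp_bounds {a : ℕ → ℝ} {L : ℝ} (hL : 1 ≤ L) (ha : ∀ n, 0 < a n)
    (h1 : ∀ n m, a (n + m) ≤ L * (a n * a m)) (h2 : ∀ n m, a n * a m ≤ L * a (n + m)) :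
    ∃ P : ℝ, ∀ n : ℕ, 1 ≤ n → Real.exp (P * n) ≤ L * a n ∧ a n ≤ L * Real.exp (P * n) := by
  have hL0 : 0 < L := zero_lt_one.trans_le hL
  have g1 : ∀ n m, Real.log (a (n + m)) ≤ Real.log L + (Real.log (a n) + Real.log (a m)) := by
    intro n m
    rw [← Real.log_mul (ha n).ne' (ha m).ne', ← Real.log_mul hL0.ne'
      (mul_pos (ha n) (ha m)).ne']
    exact Real.log_le_log (ha _) (h1 n m)
  have g2 : ∀ n m, Real.log (a n) + Real.log (a m) ≤ Real.log L + Real.log (a (n + m)) := by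
    intro n m
    rw [← Real.log_mul (ha n).ne' (ha m).ne', ← Real.log_mul hL0.ne' (ha _).ne']
    exact Real.log_le_log (mul_pos (ha n) (ha m)) (h2 n m)
  -- Fekete's lemma applies to `log a + log L` and to `-log a + log L`. Their limits cancel, and
  -- since each limit is an infimum it bounds every term, giving the two inequalities.
  have hsub : Subadditive fun n => Real.log (a n) + Real.log L := fun m n => by
    linarith [g1 m n]
  have hsub' : Subadditive fun n => -Real.log (a n) + Real.log L := fun m n => by
    linarith [g2 m n]
  have hlin : ∀ n : ℕ, |Real.log (a n)| ≤
      n * (|Real.log (a 1)| + Real.log L) + |Real.log (a 0)| := by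
    intro n
    induction n with
    | zero => simp
    | succ n ih =>
      have := g1 n 1
      have := g2 n 1
      rw [abs_le] at ih ⊢
      have h3 := abs_le.1 (le_refl |Real.log (a 1)|)
      push_cast
      constructor <;> linarith
  have hlogL : 0 ≤ Real.log L := Real.log_nonneg hL
  have hdiv : ∀ n : ℕ, |Real.log (a n) / n| ≤
      |Real.log (a 1)| + Real.log L + |Real.log (a 0)| := by
    intro n
    rcases Nat.eq_zero_or_pos n with rfl | hn
    · simp; positivity
    have hn' : (1 : ℝ) ≤ n := by exact_mod_cast hn
    rw [abs_div, Nat.abs_cast, div_le_iff₀ (by linarith)]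
    have : |Real.log (a 0)| ≤ |Real.log (a 0)| * n := le_mul_of_one_le_right (abs_nonneg _) hn'
    linarith [hlin n]
  have hb : BddBelow (range fun n : ℕ => (Real.log (a n) + Real.log L) / n) := by
    refine ⟨-(|Real.log (a 1)| + Real.log L + |Real.log (a 0)|), ?_⟩
    rintro _ ⟨n, rfl⟩
    have := (abs_le.1 (hdiv n)).1
    dsimp only
    rw [add_div]
    have : 0 ≤ Real.log L / n := by positivity
    linarith
  have hb' : BddBelow (range fun n : ℕ => (-Real.log (a n) + Real.log L) / n) := by
    refine ⟨-(|Real.log (a 1)| + Real.log L + |Real.log (a 0)|), ?_⟩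
    rintro _ ⟨n, rfl⟩
    have := (abs_le.1 (hdiv n)).2
    dsimp only
    rw [add_div, neg_div]
    have : 0 ≤ Real.log L / n := by positivity
    linarith
  have hz : Tendsto (fun n : ℕ => 2 * Real.log L / n) atTop (𝓝 0) :=
    tendsto_const_div_atTop_nhds_zero_nat _
  have heq : hsub.lim + hsub'.lim = 0 := by
    refine tendsto_nhds_unique ((hsub.tendsto_lim hb).add (hsub'.tendsto_lim hb')) (hz.congr ?_)
    intro n
    ring
  refine ⟨hsub.lim, fun n hn => ?_⟩
  have hn' : (0 : ℝ) < n := by exact_mod_cast hn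
  have k1 := hsub.lim_le_div hb (n := n) (by omega)
  have k2 := hsub'.lim_le_div hb' (n := n) (by omega)
  rw [le_div_iff₀ hn'] at k1 k2
  constructor
  · rw [← Real.le_log_iff_exp_le (mul_pos hL0 (ha n)), Real.log_mul hL0.ne' (ha n).ne']
    linarith
  · rw [← Real.log_le_log_iff (ha n) (by positivity), Real.log_mul hL0.ne' (Real.exp_pos _).ne',
      Real.log_exp]
    have : hsub'.lim = -hsub.lim := by linarith
    rw [this] at k2
    linarith

lemma exists_pressure {s : ℝ} (hs : 1 / 2 < s) :
    ∃ P : ℝ, ∀ n : ℕ, 1 ≤ n → Real.exp (P * n) ≤ distortion s * (partition s n).toReal ∧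
      (partition s n).toReal ≤ distortion s * Real.exp (P * n) := by
  have hs0 : 0 ≤ s := by linarith
  have hL := one_le_distortion hs0
  have hfin := partition_ne_top hs
  refine exists_exp_bounds hL (fun n => ENNReal.toReal_pos (partition_ne_zero s n) (hfin n)) ?_ ?_
  · intro n m
    have := ENNReal.toReal_mono (ENNReal.mul_ne_top ENNReal.ofReal_ne_top
      (ENNReal.mul_ne_top (hfin n) (hfin m))) (partition_add_le hs0 n m)
    rwa [ENNReal.toReal_mul, ENNReal.toReal_mul, ENNReal.toReal_ofReal (by linarith)] at this
  · intro n m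
    have := ENNReal.toReal_mono (ENNReal.mul_ne_top ENNReal.ofReal_ne_top (hfin _))
      (partition_mul_le hs0 n m)
    rwa [ENNReal.toReal_mul, ENNReal.toReal_mul, ENNReal.toReal_ofReal (by linarith)] at this

/-! ### Periodic measures -/

section Periodic

variable {N : ℕ} [NeZero N]

/-- The periodic two-sided sequence with period block `v`. -/
def periodic (v : Fin N → ℕ+) : ℤ → ℕ+ := fun j =>
  v ⟨(j % N).toNat, by
    have h0 : (0 : ℤ) < N := by exact_mod_cast NeZero.pos N
    have := Int.emod_nonneg j h0.ne'
    have := Int.emod_lt_of_pos j h0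
    omega⟩

lemma periodic_natCast (v : Fin N → ℕ+) {i : ℕ} (hi : i < N) : periodic v (i : ℤ) = v ⟨i, hi⟩ := by
  simp only [periodic]
  congr 2
  rw [← Int.natCast_mod, Nat.mod_eq_of_lt hi, Int.toNat_natCast]

lemma shiftZ_periodic (v : Fin N → ℕ+) : shiftZ (periodic v) = periodic fun i => v (i + 1) := by
  ext1 j
  simp only [shiftZ, periodic]
  congr 1
  ext
  have h0 : (0 : ℤ) < N := by exact_mod_cast NeZero.pos N
  have h1 := Int.emod_nonneg j h0.ne'
  have h2 := Int.emod_nonneg (j + 1) h0.ne'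
  rw [Fin.val_add, Fin.val_one', ← Int.natCast_inj]
  push_cast
  rw [Int.toNat_of_nonneg h1, Int.toNat_of_nonneg h2, ← Int.add_emod]

/-- The normalized sum of the weighted Dirac masses at the sequences of period `N`. -/
noncomputable def periodicMeasure (s : ℝ) (N : ℕ) [NeZero N] : Measure (ℤ → ℕ+) :=
  (partition s N)⁻¹ • Measure.sum fun v : Fin N → ℕ+ =>
    ENNReal.ofReal (weight s v) • Measure.dirac (periodic v)

lemma periodicMeasure_apply (s : ℝ) {B : Set (ℤ → ℕ+)} (hB : MeasurableSet B) :
    periodicMeasure s N B = (partition s N)⁻¹ * ∑' v : Fin N → ℕ+,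
      ENNReal.ofReal (weight s v) * B.indicator 1 (periodic v) := by
  simp only [periodicMeasure, Measure.smul_apply, smul_eq_mul, Measure.sum_apply _ hB,
    Measure.dirac_apply' _ hB]

lemma isProbabilityMeasure_periodicMeasure {s : ℝ} (hs : 1 / 2 < s) :
    IsProbabilityMeasure (periodicMeasure s N) := by
  refine ⟨?_⟩
  rw [periodicMeasure_apply s .univ]
  simp only [indicator_univ, Pi.one_apply, mul_one]
  exact ENNReal.inv_mul_cancel (partition_ne_zero s N) (partition_ne_top hs N)

lemma measurePreserving_periodicMeasure (s : ℝ) :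
    MeasurePreserving shiftZ (periodicMeasure s N) (periodicMeasure s N) := by
  refine ⟨measurable_shiftZ, Measure.ext fun B hB => ?_⟩
  rw [Measure.map_apply measurable_shiftZ hB, periodicMeasure_apply s (measurable_shiftZ hB),
    periodicMeasure_apply s hB]
  congr 1
  -- The shift acts on the periodic sequences as rotation of the period block, a bijection
  -- preserving weights.
  rw [← ((Equiv.addRight (1 : Fin N)).arrowCongr (Equiv.refl ℕ+)).symm.tsum_eq
    fun v => ENNReal.ofReal (weight s v) * B.indicator 1 (periodic v)]
  refine tsum_congr fun v => ?_
  rw [show ((Equiv.addRight (1 : Fin N)).arrowCongr (Equiv.refl ℕ+)).symm v =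
    fun i => v (i + 1) from rfl, weight_rotate, ← shiftZ_periodic]
  rfl

end Periodic

lemma periodic_append_mem_cylinderZ_iff {n k : ℕ} [NeZero (n + k)] (τ : ℤ → ℕ+) (v : Fin n → ℕ+)
    (w : Fin k → ℕ+) :
    periodic (Fin.append v w) ∈ cylinderZ τ n ↔ v = prefixWord n (future τ) := by
  have h : ∀ i (hi : i < n), periodic (Fin.append v w) (i : ℤ) = v ⟨i, hi⟩ := by
    intro i hi
    rw [periodic_natCast _ (by omega)]
    exact Fin.append_left v w ⟨i, hi⟩
  simp only [cylinderZ, mem_ofPred_eq, prefixWord, future, funext_iff]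
  constructor
  · intro H i
    rw [← H i i.2, h i i.2]
  · intro H i hi
    rw [h i hi, H ⟨i, hi⟩]

lemma periodicMeasure_cylinderZ (s : ℝ) (n k : ℕ) [NeZero (n + k)] (τ : ℤ → ℕ+) :
    periodicMeasure s (n + k) (cylinderZ τ n) = (partition s (n + k))⁻¹ *
      ∑' w : Fin k → ℕ+, ENNReal.ofReal (weight s (Fin.append (prefixWord n (future τ)) w)) := by
  rw [periodicMeasure_apply s (measurableSet_cylinderZ _ _), tsum_append,
    tsum_eq_single (prefixWord n (future τ))]
  · congr 1
    refine tsum_congr fun w => ?_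
    rw [indicator_of_mem ((periodic_append_mem_cylinderZ_iff τ _ w).2 rfl)]
    simp
  · intro v hv
    refine ENNReal.tsum_eq_zero.2 fun w => ?_
    rw [indicator_of_notMem fun h => hv ((periodic_append_mem_cylinderZ_iff τ v w).1 h), mul_zero]

/-- The Gibbs estimate for periodic measures, in terms of weights. -/
lemma periodicMeasure_bounds {s : ℝ} (hs : 1 / 2 < s) {N n : ℕ} [NeZero N] (hn : n ≤ N)
    (τ : ℤ → ℕ+) :
    partition s n * periodicMeasure s N (cylinderZ τ n) ≤
        ENNReal.ofReal (distortion s ^ 2) * ENNReal.ofReal (weight s (prefixWord n (future τ))) ∧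
      ENNReal.ofReal (weight s (prefixWord n (future τ))) ≤
        ENNReal.ofReal (distortion s ^ 2) *
          (partition s n * periodicMeasure s N (cylinderZ τ n)) := by
  have hs0 : 0 ≤ s := by linarith
  obtain ⟨k, rfl⟩ := Nat.exists_eq_add_of_le hn
  rw [periodicMeasure_cylinderZ, sq, ENNReal.ofReal_mul (zero_le_one.trans (one_le_distortion hs0))]
  -- Up to a factor `L`, the sum over continuations is `w * partition s k` and `Z` is `partition s n
  -- * partition s k`. The factor depending on `k` cancels, so the constant does not depend on the
  -- period.
  have h1 := tsum_weight_append_le hs0 k (prefixWord n (future τ))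
  have h2 := weight_mul_partition_le hs0 k (prefixWord n (future τ))
  have h3 := partition_add_le hs0 n k
  have h4 := partition_mul_le hs0 n k
  set L := ENNReal.ofReal (distortion s)
  set w := ENNReal.ofReal (weight s (prefixWord n (future τ)))
  set S := ∑' v : Fin k → ℕ+, ENNReal.ofReal (weight s (Fin.append (prefixWord n (future τ)) v))
  set Z := partition s (n + k)
  have hZ : Z⁻¹ * Z = 1 := ENNReal.inv_mul_cancel (partition_ne_zero s _) (partition_ne_top hs _)
  constructor
  · calc partition s n * (Z⁻¹ * S) ≤ partition s n * (Z⁻¹ * (L * (w * partition s k))) := by gcongr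
      _ = Z⁻¹ * L * w * (partition s n * partition s k) := by ring
      _ ≤ Z⁻¹ * L * w * (L * Z) := by gcongr
      _ = L * L * w * (Z⁻¹ * Z) := by ring
      _ = L * L * w := by rw [hZ, mul_one]
  · calc w = Z⁻¹ * Z * w := by rw [hZ, one_mul]
      _ ≤ Z⁻¹ * (L * (partition s n * partition s k)) * w := by gcongr
      _ = Z⁻¹ * L * partition s n * (w * partition s k) := by ring
      _ ≤ Z⁻¹ * L * partition s n * (L * S) := by gcongr
      _ = L * L * (partition s n * (Z⁻¹ * S)) := by ring

/-! ### Existence of the Gibbs states -/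

lemma iterate_shiftZ_coord {μ : Measure (ℤ → ℕ+)} (hμ : MeasurePreserving shiftZ μ μ) (i : ℤ)
    (S : Set ℕ+) : μ {τ | τ i ∈ S} = μ {τ | τ 0 ∈ S} := by
  have hm : ∀ j : ℤ, MeasurableSet {τ : ℤ → ℕ+ | τ j ∈ S} := fun j =>
    measurable_pi_apply j (MeasurableSet.of_discrete (s := S))
  rcases le_total 0 i with hi | hi
  · rw [← (hμ.iterate i.toNat).measure_preimage (hm 0).nullMeasurableSet]
    congr 1
    ext τ
    simp [shiftZ_iterate, hi]
  · rw [← (hμ.iterate (-i).toNat).measure_preimage (hm i).nullMeasurableSet]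
    congr 1
    ext τ
    simp [shiftZ_iterate, hi]

lemma periodicMeasure_letter_le {s : ℝ} (hs : 1 / 2 < s) {N : ℕ} [NeZero N] (k : ℕ+) :
    periodicMeasure s N {τ | τ 0 = k} ≤ (partition s 1)⁻¹ *
      (ENNReal.ofReal (distortion s ^ 2) * ENNReal.ofReal (((k : ℕ) : ℝ) ^ (-(2 * s)))) := by
  have h := (periodicMeasure_bounds hs (N := N) (n := 1) (NeZero.one_le) fun _ => k).1
  rw [weight_one] at h
  have hc : cylinderZ (fun _ => k) 1 = {τ | τ 0 = k} := by
    ext τ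
    simp [cylinderZ]
  rw [hc] at h
  rwa [← ENNReal.mul_le_iff_le_inv (partition_ne_zero s 1) (partition_ne_top hs 1)]

/-- Uniform tail estimate for the letters under the periodic measures. -/
lemma exists_letter_bound {s : ℝ} (hs : 1 / 2 < s) {ε : ENNReal} (hε : ε ≠ 0) :
    ∃ F : Finset ℕ+, ∀ (N : ℕ) [NeZero N] (i : ℤ), periodicMeasure s N {τ | τ i ∉ F} ≤ ε := by
  set b : ℕ+ → ENNReal := fun k => (partition s 1)⁻¹ *
      (ENNReal.ofReal (distortion s ^ 2) * ENNReal.ofReal (((k : ℕ) : ℝ) ^ (-(2 * s))))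
  have hb : ∑' k, b k ≠ ⊤ := by
    simp only [b, ENNReal.tsum_mul_left]
    exact ENNReal.mul_ne_top (ENNReal.inv_ne_top.2 (partition_ne_zero s 1))
      (ENNReal.mul_ne_top ENNReal.ofReal_ne_top (tsum_rpow_ne_top hs))
  have ht := ENNReal.tendsto_tsum_compl_atTop_zero hb
  obtain ⟨F, hF⟩ := (ht.eventually_le_const (pos_iff_ne_zero.2 hε)).exists
  refine ⟨F, fun N _ i => ?_⟩
  rw [show {τ : ℤ → ℕ+ | τ i ∉ F} = {τ | τ i ∈ {k | k ∉ F}} from rfl,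
    iterate_shiftZ_coord (measurePreserving_periodicMeasure s)]
  calc periodicMeasure s N {τ | τ 0 ∈ {k | k ∉ F}}
      ≤ periodicMeasure s N (⋃ k : {k // k ∉ F}, {τ | τ 0 = k}) := by
        refine measure_mono fun τ hτ => ?_
        exact mem_iUnion.2 ⟨⟨τ 0, hτ⟩, rfl⟩
    _ ≤ ∑' k : {k // k ∉ F}, periodicMeasure s N {τ | τ 0 = k} := measure_iUnion_le _
    _ ≤ ∑' k : {k // k ∉ F}, b k := ENNReal.tsum_le_tsum fun k => periodicMeasure_letter_le hs _
    _ ≤ ε := hF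

lemma isTightMeasureSet_periodicMeasure {s : ℝ} (hs : 1 / 2 < s) :
    IsTightMeasureSet (range fun N : ℕ => periodicMeasure s (N + 1)) := by
  rw [isTightMeasureSet_iff_exists_isCompact_measure_compl_le]
  intro ε hε
  -- Each coordinate is confined to a finite set up to an error `δ i` with summable total; a product
  -- of finite sets is compact.
  obtain ⟨δ, hδ, hsum⟩ := ENNReal.exists_pos_sum_of_countable' hε.ne' ℤ
  choose F hF using fun i => exists_letter_bound hs (hδ i).ne'
  refine ⟨univ.pi fun i => (F i : Set ℕ+), isCompact_univ_pi fun i => (F i).finite_toSet.isCompact,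
    ?_⟩
  rintro _ ⟨N, rfl⟩
  calc periodicMeasure s (N + 1) (univ.pi fun i => (F i : Set ℕ+))ᶜ
      ≤ periodicMeasure s (N + 1) (⋃ i, {τ | τ i ∉ F i}) := by
        refine measure_mono fun τ hτ => ?_
        simpa [Set.mem_pi] using hτ
    _ ≤ ∑' i, periodicMeasure s (N + 1) {τ | τ i ∉ F i} := measure_iUnion_le _
    _ ≤ ∑' i, δ i := ENNReal.tsum_le_tsum fun i => hF i _ i
    _ ≤ ε := hsum.le

lemma isClopen_cylinderZ (τ : ℤ → ℕ+) (n : ℕ) : IsClopen (cylinderZ τ n) := by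
  have : cylinderZ τ n = ⋂ i ∈ Finset.range n, (fun ω : ℤ → ℕ+ => ω (i : ℤ)) ⁻¹' {τ i} := by
    ext ω; simp [cylinderZ]
  rw [this]
  exact isClopen_biInter_finset fun i _ => (isClopen_discrete _).preimage (continuous_apply _)

lemma continuous_shiftZ : Continuous shiftZ := continuous_pi fun _ => continuous_apply _

theorem exists_isGibbsStateZ {s : ℝ} (hs : 1 / 2 < s) :
    ∃ μ, IsGibbsStateZ (fun τ => zeta s (future τ)) μ := by
  have hs0 : 0 ≤ s := by linarith
  have hL := one_le_distortion hs0
  let ν : ℕ → ProbabilityMeasure (ℤ → ℕ+) := fun N =>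
    ⟨periodicMeasure s (N + 1), isProbabilityMeasure_periodicMeasure hs⟩
  have hcomp : IsCompact (closure (range ν)) := by
    refine isCompact_closure_of_isTightMeasureSet ?_
    convert isTightMeasureSet_periodicMeasure hs using 1
    ext μ
    constructor
    · rintro ⟨_, ⟨N, rfl⟩, rfl⟩
      exact ⟨N, rfl⟩
    · rintro ⟨N, rfl⟩
      exact ⟨ν N, ⟨N, rfl⟩, rfl⟩
  -- Compactness gives a limit along a nonprincipal ultrafilter, so no subsequence has to be chosen.
  obtain ⟨μ, -, hμ⟩ := hcomp.ultrafilter_le_nhds ((hyperfilter ℕ).map ν) (by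
    rw [le_principal_iff]
    exact mem_of_superset (Filter.range_mem_map) subset_closure)
  have hlim : Tendsto ν (hyperfilter ℕ) (𝓝 μ) := hμ
  have hinv : MeasurePreserving shiftZ (μ : Measure (ℤ → ℕ+)) μ := by
    have h1 := ProbabilityMeasure.tendsto_map_of_tendsto_of_continuous ν μ hlim continuous_shiftZ
    have h2 : (fun N => (ν N).map continuous_shiftZ.aemeasurable) = ν := by
      ext1 N
      exact Subtype.ext (measurePreserving_periodicMeasure s).map_eq
    rw [h2] at h1
    exact ⟨measurable_shiftZ, congrArg
      (fun ρ : ProbabilityMeasure (ℤ → ℕ+) => (ρ : Measure (ℤ → ℕ+))) (tendsto_nhds_unique h1 hlim)⟩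
  -- Cylinders are clopen, so weak convergence gives convergence of their masses and the uniform
  -- bounds survive.
  have hcyl : ∀ τ n, Tendsto (fun N => (ν N : Measure (ℤ → ℕ+)).real (cylinderZ τ n))
      (hyperfilter ℕ) (𝓝 ((μ : Measure (ℤ → ℕ+)).real (cylinderZ τ n))) := fun τ n =>
    NNReal.tendsto_coe.2 (ProbabilityMeasure.tendsto_measure_of_isClopen_of_tendsto hlim
      (isClopen_cylinderZ τ n))
  have hw : ∀ τ n, (partition s n).toReal * (μ : Measure (ℤ → ℕ+)).real (cylinderZ τ n) ≤
        distortion s ^ 2 * weight s (prefixWord n (future τ)) ∧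
      weight s (prefixWord n (future τ)) ≤ distortion s ^ 2 *
        ((partition s n).toReal * (μ : Measure (ℤ → ℕ+)).real (cylinderZ τ n)) := by
    intro τ n
    have hev : ∀ᶠ N in (hyperfilter ℕ : Filter ℕ), n ≤ N + 1 :=
      (Nat.hyperfilter_le_atTop) ((eventually_ge_atTop n).mono fun N h => h.trans N.le_succ)
    have hwp := weight_pos s (prefixWord n (future τ))
    have hfin : ∀ N, partition s n * periodicMeasure s (N + 1) (cylinderZ τ n) ≠ ⊤ := fun N =>
      ENNReal.mul_ne_top (partition_ne_top hs n) (measure_ne_top (ν N : Measure (ℤ → ℕ+)) _)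
    constructor
    · refine le_of_tendsto ((hcyl τ n).const_mul _) (hev.mono fun N hN => ?_)
      have := ENNReal.toReal_mono (ENNReal.mul_ne_top ENNReal.ofReal_ne_top ENNReal.ofReal_ne_top)
        (periodicMeasure_bounds hs hN τ).1
      rwa [ENNReal.toReal_mul, ENNReal.toReal_mul, ENNReal.toReal_ofReal (by positivity),
        ENNReal.toReal_ofReal hwp.le] at this
    · refine ge_of_tendsto (((hcyl τ n).const_mul _).const_mul _) (hev.mono fun N hN => ?_)
      have := ENNReal.toReal_mono (ENNReal.mul_ne_top ENNReal.ofReal_ne_top (hfin N))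
        (periodicMeasure_bounds hs hN τ).2
      rwa [ENNReal.toReal_mul, ENNReal.toReal_mul, ENNReal.toReal_ofReal hwp.le,
        ENNReal.toReal_ofReal (by positivity)] at this
  obtain ⟨P, hP⟩ := exists_pressure hs
  -- Two factors come from the periodic measures, one from replacing weights by Birkhoff sums, one
  -- from replacing the partition function by `exp (P * n)`.
  refine ⟨μ, inferInstance, hinv, distortion s ^ 4, one_le_pow₀ hL, P, fun n hn τ => ?_⟩
  rw [div_bounds_iff (by positivity) (Real.exp_pos _), birkhoffSum_future, Real.exp_sub]
  obtain ⟨a1, a2⟩ := hw τ n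
  obtain ⟨b1, b2⟩ := hP n hn
  obtain ⟨c1, c2⟩ := weight_bounds hs0 n (future τ)
  have hE := Real.exp_pos (P * n)
  have hm : 0 ≤ (μ : Measure (ℤ → ℕ+)).real (cylinderZ τ n) := measureReal_nonneg
  set L := distortion s
  set m := (μ : Measure (ℤ → ℕ+)).real (cylinderZ τ n)
  set Z := (partition s n).toReal
  set E := Real.exp (P * n)
  set w := weight s (prefixWord n (future τ))
  set x := Real.exp (birkhoffSum shift (zeta s) n (future τ))
  constructor
  · rw [mul_div_assoc', le_div_iff₀ hE]
    calc m * E ≤ m * (L * Z) := by gcongr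
      _ = L * (Z * m) := by ring
      _ ≤ L * (L ^ 2 * (L * x)) := mul_le_mul_of_nonneg_left (a1.trans (by gcongr)) (by positivity)
      _ = L ^ 4 * x := by ring
  · rw [div_le_iff₀ hE]
    calc x ≤ L * w := c2
      _ ≤ L * (L ^ 2 * ((L * E) * m)) := mul_le_mul_of_nonneg_left (a2.trans (by gcongr)) (by positivity)
      _ = L ^ 4 * m * E := by ring

/-! ### Counting -/

lemma finite_lt_and (P : ℕ → Prop) (n : ℕ) : {k | k < n ∧ P k}.Finite :=
  (finite_Iio n).subset fun _ hk => hk.1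

lemma ncard_lt_and_le_of_imp_add {P Q : ℕ → Prop} {m : ℕ} (h : ∀ k, Q k → P (k + m)) (n : ℕ) :
    {k | k < n ∧ Q k}.ncard ≤ {k | k < n ∧ P k}.ncard + m := by
  rw [← ncard_image_of_injective {k | k < n ∧ Q k} (add_left_injective m)]
  have hsub : (fun k => k + m) '' {k | k < n ∧ Q k} ⊆ {k | k < n ∧ P k} ∪ Ico n (n + m) := by
    rintro _ ⟨k, ⟨hk, hQ⟩, rfl⟩
    by_cases hkm : k + m < n
    · exact Or.inl ⟨hkm, h k hQ⟩
    · exact Or.inr ⟨not_lt.1 hkm, by simpa using hk⟩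
  refine (ncard_le_ncard hsub ((finite_lt_and P n).union (finite_Ico _ _))).trans
    ((ncard_union_le _ _).trans ?_)
  rw [← Finset.coe_Ico, ncard_coe_finset, Nat.card_Ico]
  omega

lemma ncard_lt_and_le_of_add_imp {P Q : ℕ → Prop} {m : ℕ} (h : ∀ k, P (k + m) → Q k) (n : ℕ) :
    {k | k < n ∧ P k}.ncard ≤ {k | k < n ∧ Q k}.ncard + m := by
  have hsub : {k | k < n ∧ P k} ⊆ (fun k => k + m) '' {k | k < n ∧ Q k} ∪ Iio m := by
    rintro k ⟨hk, hP⟩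
    by_cases hkm : k < m
    · exact Or.inr hkm
    · obtain ⟨j, rfl⟩ := Nat.exists_eq_add_of_le' (not_lt.1 hkm)
      exact Or.inl ⟨j, ⟨by omega, h j hP⟩, rfl⟩
  refine (ncard_le_ncard hsub (((finite_lt_and Q n).image _).union (finite_Iio _))).trans
    ((ncard_union_le _ _).trans ?_)
  rw [ncard_image_of_injective _ (add_left_injective m), ← Finset.coe_Iio, ncard_coe_finset,
    Nat.card_Iio]

lemma birkhoffAverage_indicator {X : Type*} (f : X → X) (A : Set X) (n : ℕ) (x : X) :
    birkhoffAverage ℝ f (A.indicator 1) n x = ({k | k < n ∧ f^[k] x ∈ A}.ncard : ℝ) / n := by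
  classical
  have h : {k | k < n ∧ f^[k] x ∈ A} = ((Finset.range n).filter fun k => f^[k] x ∈ A : Finset ℕ) := by
    ext; simp
  rw [birkhoffAverage, birkhoffSum, h, ncard_coe_finset, smul_eq_mul, inv_mul_eq_div,
    Finset.card_filter]
  simp [indicator_apply]

/-! ### Equidistribution of the pairs `(T_k, V_k)` -/

lemma measurable_revCoding (m : ℕ) : Measurable (revCoding m) := by
  have hm : ∀ l : List ℕ, Measurable fun ω : ℕ → ℕ+ => cfFin (l.map fun i => (ω i : ℕ)) := by
    intro l
    induction l with
    | nil => simp [cfFin]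
    | cons a l ih =>
      simp only [cfFin, List.map_cons, List.foldr_cons, branch] at ih ⊢
      have hc : Measurable fun ω : ℕ → ℕ+ => ((ω a : ℕ) : ℝ) :=
        (measurable_from_top (f := fun m : ℕ+ => ((m : ℕ) : ℝ))).comp (measurable_pi_apply a)
      exact (hc.add ih).const_div 1
  have h : revCoding m = fun ω => cfFin ((List.range m).reverse.map fun i => (ω i : ℕ)) := by
    ext ω
    rw [revCoding, List.map_reverse]
  rw [h]
  exact hm _

/-- The one-sided sequences whose `m`-th shift is coded by a point of `(a, b)` and whose first `m`
letters, read backwards, give a point of `(c, d)`. -/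
def approxBox (m : ℕ) (a b c d : ℝ) : Set (ℕ → ℕ+) :=
  {ω | coding (shift^[m] ω) ∈ Ioo a b ∧ revCoding m ω ∈ Ioo c d}

lemma measurableSet_approxBox (m : ℕ) (a b c d : ℝ) : MeasurableSet (approxBox m a b c d) :=
  ((measurable_coding.comp (measurable_shift.iterate m)) measurableSet_Ioo).inter
    (measurable_revCoding m measurableSet_Ioo)

section Equidistribution

variable {ψ : (ℕ → ℕ+) → ℝ} {μ : Measure (ℤ → ℕ+)}

/-- Invariance recentres the sequence at position `m`, turning its first `m` letters into the recent
past. -/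
lemma measureReal_approxBox (hμ : MeasurePreserving shiftZ μ μ) (m : ℕ) (a b c d : ℝ) :
    (μ.map future).real (approxBox m a b c d) = μ.real {τ | coding (future τ) ∈ Ioo a b ∧
      revCoding m (future fun i => τ (i - m)) ∈ Ioo c d} := by
  have hback : Measurable fun (τ : ℤ → ℕ+) (i : ℤ) => τ (i - m) :=
    measurable_pi_lambda _ fun _ => measurable_pi_apply _
  have hS : MeasurableSet {τ : ℤ → ℕ+ | coding (future τ) ∈ Ioo a b ∧
      revCoding m (future fun i => τ (i - m)) ∈ Ioo c d} :=
    ((measurable_coding.comp measurable_future) measurableSet_Ioo).inter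
      (((measurable_revCoding m).comp (measurable_future.comp hback)) measurableSet_Ioo)
  rw [map_measureReal_apply measurable_future (measurableSet_approxBox _ _ _ _ _),
    ← (hμ.iterate m).measureReal_preimage hS.nullMeasurableSet]
  congr 1
  ext τ
  have h1 : future (shiftZ^[m] τ) = shift^[m] (future τ) := by
    rw [shiftZ_iterate, shift_iterate]
    ext i
    simp [future, add_comm]
  have h2 : (fun i : ℤ => shiftZ^[m] τ (i - m)) = τ := by
    ext i
    simp [shiftZ_iterate]
  simp only [approxBox, mem_preimage, mem_ofPred_eq, h1, h2]

lemma measureReal_approxBox_le [IsProbabilityMeasure μ] (hμ : MeasurePreserving shiftZ μ μ)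
    (m : ℕ) (a b c d : ℝ) :
    (μ.map future).real (approxBox m a b c d) ≤ (μ.map codingZ).real
      (Ioo a b ×ˢ Ioo (c - 2 * (1 / 2) ^ m) (d + 2 * (1 / 2) ^ m)) := by
  rw [measureReal_approxBox hμ, map_measureReal_apply measurable_codingZ
    (measurableSet_Ioo.prod measurableSet_Ioo)]
  refine measureReal_mono ?_
  rintro τ ⟨h1, h2, h3⟩
  have := abs_le.1 (abs_revCoding_sub_coding_past_le m τ)
  refine ⟨h1, ?_, ?_⟩ <;> simp only [codingZ] <;> linarith

lemma le_measureReal_approxBox [IsProbabilityMeasure μ] (hμ : MeasurePreserving shiftZ μ μ)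
    (m : ℕ) (a b c d : ℝ) :
    (μ.map codingZ).real (Ioo a b ×ˢ Ioo (c + 2 * (1 / 2) ^ m) (d - 2 * (1 / 2) ^ m)) ≤
      (μ.map future).real (approxBox m a b c d) := by
  rw [measureReal_approxBox hμ, map_measureReal_apply measurable_codingZ
    (measurableSet_Ioo.prod measurableSet_Ioo)]
  refine measureReal_mono ?_
  rintro τ ⟨h1, h2, h3⟩
  have := abs_le.1 (abs_revCoding_sub_coding_past_le m τ)
  simp only [codingZ] at h1 h2 h3
  exact ⟨h1, by linarith, by linarith⟩

lemma ae_codingZ_fst_ne [IsProbabilityMeasure μ] (h : IsGibbsState ψ (μ.map future)) (a : ℝ) :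
    ∀ᵐ p ∂(μ.map codingZ), p.1 ≠ a := by
  refine (ae_map_iff measurable_codingZ.aemeasurable
    (measurable_fst (measurableSet_singleton a).compl)).2 ?_
  by_cases ha : ∃ ω, coding ω = a
  · obtain ⟨ω, rfl⟩ := ha
    have h0 : μ {τ | future τ = ω} = 0 := (measureReal_eq_zero_iff).1 (measureReal_future_fiber h ω)
    filter_upwards [measure_eq_zero_iff_ae_notMem.1 h0] with τ hτ hc
    exact hτ (coding_injective hc)
  · exact ae_of_all _ fun τ hτ => ha ⟨_, hτ⟩

lemma ae_codingZ_snd_ne [IsProbabilityMeasure μ] (hμ : MeasurePreserving shiftZ μ μ)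
    (h : IsGibbsState ψ (μ.map future)) (a : ℝ) : ∀ᵐ p ∂(μ.map codingZ), p.2 ≠ a := by
  refine (ae_map_iff measurable_codingZ.aemeasurable
    (measurable_snd (measurableSet_singleton a).compl)).2 ?_
  by_cases ha : ∃ ω, coding ω = a
  · obtain ⟨ω, rfl⟩ := ha
    have h0 : μ {τ | past τ = ω} = 0 := (measureReal_eq_zero_iff).1 (measureReal_past_fiber hμ h ω)
    filter_upwards [measure_eq_zero_iff_ae_notMem.1 h0] with τ hτ hc
    exact hτ (coding_injective hc)
  · exact ae_of_all _ fun τ hτ => ha ⟨_, hτ⟩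

end Equidistribution

/-! ### Approximating open boxes from inside and outside -/

lemma exists_inner_box {κ : Measure (ℝ × ℝ)} [IsProbabilityMeasure κ] {a b c d t : ℝ}
    (ht : t < κ.real (Ioo a b ×ˢ Ioo c d)) :
    ∃ δ > 0, t < κ.real (Ioo (a + δ) (b - δ) ×ˢ Ioo (c + δ) (d - δ)) := by
  obtain ⟨u, hu, hu0, hul⟩ := exists_seq_strictAnti_tendsto (0 : ℝ)
  set S : ℕ → Set (ℝ × ℝ) := fun n => Ioo (a + u n) (b - u n) ×ˢ Ioo (c + u n) (d - u n)
  have hmono : Monotone S := by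
    intro m n hmn
    have := hu.antitone hmn
    exact prod_mono (Ioo_subset_Ioo (by linarith) (by linarith))
      (Ioo_subset_Ioo (by linarith) (by linarith))
  have hun : ⋃ n, S n = Ioo a b ×ˢ Ioo c d := by
    ext ⟨x, y⟩
    simp only [S, mem_iUnion, mem_prod, mem_Ioo]
    constructor
    · rintro ⟨n, ⟨h1, h2⟩, h3, h4⟩
      have := hu0 n
      exact ⟨⟨by linarith, by linarith⟩, by linarith, by linarith⟩
    · rintro ⟨⟨h1, h2⟩, h3, h4⟩
      obtain ⟨n, hn⟩ := (hul.eventually_lt_const (lt_min (lt_min (sub_pos.2 h1) (sub_pos.2 h2))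
        (lt_min (sub_pos.2 h3) (sub_pos.2 h4)))).exists
      simp only [lt_min_iff] at hn
      exact ⟨n, ⟨by linarith, by linarith⟩, by linarith, by linarith⟩
  have hlim := (ENNReal.tendsto_toReal (measure_ne_top κ _)).comp
    (tendsto_measure_iUnion_atTop (μ := κ) hmono)
  rw [hun] at hlim
  obtain ⟨n, hn⟩ := (hlim.eventually_const_lt ht).exists
  exact ⟨u n, hu0 n, hn⟩

lemma exists_outer_box {κ : Measure (ℝ × ℝ)} [IsProbabilityMeasure κ]
    (h1 : ∀ a, ∀ᵐ p ∂κ, p.1 ≠ a) (h2 : ∀ a, ∀ᵐ p ∂κ, p.2 ≠ a) {a b c d t : ℝ}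
    (ht : κ.real (Ioo a b ×ˢ Ioo c d) < t) :
    ∃ δ > 0, κ.real (Ioo (a - δ) (b + δ) ×ˢ Ioo (c - δ) (d + δ)) < t := by
  obtain ⟨u, hu, hu0, hul⟩ := exists_seq_strictAnti_tendsto (0 : ℝ)
  set S : ℕ → Set (ℝ × ℝ) := fun n => Ioo (a - u n) (b + u n) ×ˢ Ioo (c - u n) (d + u n)
  have hanti : Antitone S := by
    intro m n hmn
    have := hu.antitone hmn
    exact prod_mono (Ioo_subset_Ioo (by linarith) (by linarith))
      (Ioo_subset_Ioo (by linarith) (by linarith))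
  have hin : ⋂ n, S n = Icc a b ×ˢ Icc c d := by
    ext ⟨x, y⟩
    simp only [S, mem_iInter, mem_prod, mem_Ioo, mem_Icc]
    constructor
    · intro h
      refine ⟨⟨?_, ?_⟩, ?_, ?_⟩
      · exact le_of_tendsto' (by simpa using hul.const_sub a) fun n => (h n).1.1.le
      · exact ge_of_tendsto' (by simpa using hul.const_add b) fun n => (h n).1.2.le
      · exact le_of_tendsto' (by simpa using hul.const_sub c) fun n => (h n).2.1.le
      · exact ge_of_tendsto' (by simpa using hul.const_add d) fun n => (h n).2.2.le
    · rintro ⟨⟨g1, g2⟩, g3, g4⟩ n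
      have := hu0 n
      exact ⟨⟨by linarith, by linarith⟩, by linarith, by linarith⟩
  -- The enlarged boxes shrink only to the closed box; its boundary lies on four null lines.
  have hcongr : κ (Icc a b ×ˢ Icc c d) = κ (Ioo a b ×ˢ Ioo c d) := by
    refine measure_congr ?_
    filter_upwards [h1 a, h1 b, h2 c, h2 d] with p ha hb hc hd
    refine propext ⟨fun hp => ?_, fun hp => ⟨Ioo_subset_Icc_self hp.1, Ioo_subset_Icc_self hp.2⟩⟩
    exact ⟨⟨lt_of_le_of_ne hp.1.1 ha.symm, lt_of_le_of_ne hp.1.2 hb⟩,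
      lt_of_le_of_ne hp.2.1 hc.symm, lt_of_le_of_ne hp.2.2 hd⟩
  have hlim := (ENNReal.tendsto_toReal (measure_ne_top κ _)).comp
    (tendsto_measure_iInter_atTop (μ := κ)
      (fun n => (measurableSet_Ioo.prod measurableSet_Ioo).nullMeasurableSet) hanti
      ⟨0, measure_ne_top κ _⟩)
  rw [hin, hcongr] at hlim
  obtain ⟨n, hn⟩ := (hlim.eventually_lt_const ht).exists
  exact ⟨u n, hu0 n, hn⟩

lemma exists_two_mul_half_pow_lt {δ : ℝ} (hδ : 0 < δ) : ∃ m : ℕ, 2 * (1 / 2 : ℝ) ^ m < δ := by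
  obtain ⟨m, hm⟩ := exists_pow_lt_of_lt_one (half_pos hδ) (by norm_num : (1 / 2 : ℝ) < 1)
  exact ⟨m, by linarith⟩

theorem ae_tendsto_frequency {ψ : (ℕ → ℕ+) → ℝ} {μ : Measure (ℤ → ℕ+)}
    (h : IsGibbsStateZ (fun τ => ψ (future τ)) μ) :
    ∀ᵐ ω ∂(μ.map future), ∀ a b c d : ℝ,
      Tendsto (fun n : ℕ => ({k : ℕ | k < n ∧
          (T k (coding ω), V k (coding ω)) ∈ Ioo a b ×ˢ Ioo c d}.ncard : ℝ) / n) atTop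
        (𝓝 ((μ.map codingZ).real (Ioo a b ×ˢ Ioo c d))) := by
  have hprob := h.1
  have hμ := h.2.1
  have hG := h.map_future
  have hprob' := hG.1
  have hκ : IsProbabilityMeasure (μ.map codingZ) :=
    Measure.isProbabilityMeasure_map measurable_codingZ.aemeasurable
  -- Rational corners leave countably many sets, so a single null set serves all real boxes.
  have hae : ∀ᵐ ω ∂(μ.map future), ∀ (m : ℕ) (a b c d : ℚ),
      Tendsto (fun n : ℕ => ({k : ℕ | k < n ∧ shift^[k] ω ∈ approxBox m a b c d}.ncard : ℝ) / n)
        atTop (𝓝 ((μ.map future).real (approxBox m a b c d))) := by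
    simp only [ae_all_iff]
    intro m a b c d
    have hA := measurableSet_approxBox m a b c d
    have := tendsto_birkhoffAverage_of_ergodic hG.ergodic
      (measurable_one.indicator hA : Measurable ((approxBox m a b c d).indicator (1 : (ℕ → ℕ+) → ℝ)))
      (B := 1) (fun ω => by
        by_cases hω : ω ∈ approxBox m a b c d <;> simp [hω])
    rw [integral_indicator_one hA] at this
    simpa only [birkhoffAverage_indicator] using this
  filter_upwards [hae] with ω hω a b c d
  have hV : ∀ m k, |V (k + m) (coding ω) - revCoding m (shift^[k] ω)| ≤ 2 * (1 / 2) ^ m := by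
    intro m k
    rw [V_coding]
    exact abs_revCoding_sub_le m k ω
  have hT : ∀ m k, T (k + m) (coding ω) = coding (shift^[m] (shift^[k] ω)) := by
    intro m k
    rw [T_coding, ← Function.iterate_add_apply, add_comm]
  have hzero : ∀ m : ℕ, Tendsto (fun n : ℕ => (m : ℝ) / n) atTop (𝓝 0) := fun m =>
    tendsto_const_div_atTop_nhds_zero_nat _
  rw [tendsto_order]
  constructor
  · intro t ht
    obtain ⟨δ, hδ, htδ⟩ := exists_inner_box ht
    obtain ⟨m, hm⟩ := exists_two_mul_half_pow_lt (show 0 < δ / 3 by linarith)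
    obtain ⟨a', ha1, ha2⟩ := exists_rat_btwn (show a < a + δ by linarith)
    obtain ⟨b', hb1, hb2⟩ := exists_rat_btwn (show b - δ < b by linarith)
    -- The margin between `c` and `c'` absorbs the error of `revCoding` against `V`, the one between
    -- `c'` and `c + δ` its error against the infinite past; each error is below `δ / 3`.
    obtain ⟨c', hc1, hc2⟩ := exists_rat_btwn (show c + δ / 3 < c + 2 * δ / 3 by linarith)
    obtain ⟨d', hd1, hd2⟩ := exists_rat_btwn (show d - 2 * δ / 3 < d - δ / 3 by linarith)
    have hlt : t < (μ.map future).real (approxBox m a' b' c' d') := by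
      refine htδ.trans_le (le_trans (measureReal_mono (prod_mono ?_ ?_))
        (le_measureReal_approxBox hμ m a' b' c' d'))
      · exact Ioo_subset_Ioo ha2.le hb1.le
      · exact Ioo_subset_Ioo (by linarith) (by linarith)
    -- Time `k` of the shifted orbit corresponds to index `k + m` of the pairs, which changes the
    -- count by at most `m`, negligible after division by `n`.
    have hlim := (hω m a' b' c' d').sub (hzero m)
    rw [sub_zero] at hlim
    filter_upwards [hlim.eventually_const_lt hlt, eventually_gt_atTop 0] with n hn hn0
    refine hn.trans_le ?_
    rw [← sub_div]
    gcongr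
    rw [sub_le_iff_le_add]
    have := ncard_lt_and_le_of_imp_add (m := m)
      (P := fun k => (T k (coding ω), V k (coding ω)) ∈ Ioo a b ×ˢ Ioo c d)
      (Q := fun k => shift^[k] ω ∈ approxBox m a' b' c' d') (by
        rintro k ⟨h1, h2, h3⟩
        have := abs_le.1 (hV m k)
        refine ⟨?_, by dsimp only; linarith, by dsimp only; linarith⟩
        rw [hT]
        exact Ioo_subset_Ioo ha1.le hb2.le h1) n
    exact_mod_cast this
  · intro t ht
    obtain ⟨δ, hδ, htδ⟩ := exists_outer_box (ae_codingZ_fst_ne hG) (ae_codingZ_snd_ne hμ hG) ht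
    obtain ⟨m, hm⟩ := exists_two_mul_half_pow_lt (show 0 < δ / 3 by linarith)
    obtain ⟨a', ha1, ha2⟩ := exists_rat_btwn (show a - δ < a by linarith)
    obtain ⟨b', hb1, hb2⟩ := exists_rat_btwn (show b < b + δ by linarith)
    obtain ⟨c', hc1, hc2⟩ := exists_rat_btwn (show c - 2 * δ / 3 < c - δ / 3 by linarith)
    obtain ⟨d', hd1, hd2⟩ := exists_rat_btwn (show d + δ / 3 < d + 2 * δ / 3 by linarith)
    have hlt : (μ.map future).real (approxBox m a' b' c' d') < t := by
      refine lt_of_le_of_lt ((measureReal_approxBox_le hμ m a' b' c' d').trans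
        (measureReal_mono (prod_mono ?_ ?_))) htδ
      · exact Ioo_subset_Ioo ha1.le hb2.le
      · exact Ioo_subset_Ioo (by linarith) (by linarith)
    have hlim := (hω m a' b' c' d').add (hzero m)
    rw [add_zero] at hlim
    filter_upwards [hlim.eventually_lt_const hlt, eventually_gt_atTop 0] with n hn hn0
    refine lt_of_le_of_lt ?_ hn
    rw [← add_div]
    gcongr
    have := ncard_lt_and_le_of_add_imp (m := m)
      (P := fun k => (T k (coding ω), V k (coding ω)) ∈ Ioo a b ×ˢ Ioo c d)
      (Q := fun k => shift^[k] ω ∈ approxBox m a' b' c' d') (by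
        rintro k ⟨h1, h2, h3⟩
        have := abs_le.1 (hV m k)
        rw [hT] at h1
        dsimp only at h2 h3
        exact ⟨Ioo_subset_Ioo ha2.le hb1.le h1, by linarith, by linarith⟩) n
    exact_mod_cast this

/-! ### Assembly for the chosen Gibbs states -/

lemma isGibbsState_gibbsState {ψ : (ℕ → ℕ+) → ℝ} (h : ∃ ν, IsGibbsState ψ ν) :
    IsGibbsState ψ (gibbsState ψ) := by
  rw [gibbsState, dif_pos h]
  exact h.choose_spec

lemma isGibbsStateZ_gibbsStateZ {ψ : (ℤ → ℕ+) → ℝ} (h : ∃ ν, IsGibbsStateZ ψ ν) :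
    IsGibbsStateZ ψ (gibbsStateZ ψ) := by
  rw [gibbsStateZ, dif_pos h]
  exact h.choose_spec

end GaussCF

theorem theorem10p1 (s : ℝ) (hs : 1 / 2 < s) :
    (∃! ν, GaussCF.IsGibbsState (GaussCF.zeta s) ν) ∧
    (∃! ν, GaussCF.IsGibbsStateZ (fun τ => GaussCF.zeta s (GaussCF.future τ)) ν) ∧
    ∀ᵐ x ∂(GaussCF.mu s), ∀ a b c d : ℝ, a < b → c < d →
      Tendsto
        (fun n : ℕ =>
          (Set.ncard {k : ℕ | k < n ∧
            (GaussCF.T k x, GaussCF.V k x) ∈ Ioo a b ×ˢ Ioo c d} : ℝ) / n)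
        atTop (𝓝 ((GaussCF.muHat s).real (Ioo a b ×ˢ Ioo c d))) := by
  have hZ := GaussCF.isGibbsStateZ_gibbsStateZ (GaussCF.exists_isGibbsStateZ hs)
  have hG := hZ.map_future
  have hg := GaussCF.isGibbsState_gibbsState ⟨_, hG⟩
  refine ⟨⟨_, hG, fun ν hν => hG.eq hν⟩, ⟨_, hZ, fun ν hν => hZ.eq hν⟩, ?_⟩
  -- The two Gibbs states are chosen independently; one-sided uniqueness identifies the first with
  -- the future marginal of the second.
  rw [GaussCF.mu, GaussCF.measurableEmbedding_coding.ae_map_iff, hG.eq hg]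
  filter_upwards [GaussCF.ae_tendsto_frequency hZ] with ω hω a b c d _ _
  exact hω a b c d
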